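/- Let $I=[0,1]$ and let $W:I^2\to[-1,1]$ be a signed graphon (a symmetric measurable function) that is piecewise Lipschitz: there are $0=\alpha_0<\alpha_1<\dots<\alpha_{K+1}=1$ and $L$ such that $|W(x,y)-W(x',y')|\le L(|x-x'|+|y-y'|)$ whenever $x,x'\in(\alpha_{k},\alpha_{k+1})$ and $y,y'\in(\alpha_{l},\alpha_{l+1})$ for some $k,l$. Let $g:I\to\mathbb R$ be bounded and almost everywhere continuous. On a common probability space let there be given, for each $n\in\mathbb N$, latent variables $X_1,\dots,X_n\in I$ (depending on $n$), which either are deterministic for all $n$, $X_i=i/n$, or are stochastic for all $n$, $X_i=U_{(i)}$ being the order statistics of $n$ independent uniform random variables $U_1,\dots,U_n$ in $I$; and a signed graph sampled from $W$, that is, a random symmetric matrix $A^{(n)}$ with entries in $\{-1,0,1\}$ such that $A^{(n)}_{ij}=\operatorname{sign}(W(X_i,X_j))\,\eta_{ij}$ for $i<j$, where, conditionally on $X_1,\dots,X_n$, the $\eta_{ij}$, $i<j$, are independent Bernoulli variables with parameters $|W(X_i,X_j)|$. (The diagonal entries, and the joint law for different $n$, are arbitrary.) Let $u\in C^1([0,\infty);L^\infty(I))$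 and, for each $n$, $u^{(n)}:[0,\infty)\to\mathbb R^n$ be the solutions with initial conditions $u(x,0)=g(x)$ and $u^{(n)}_i(0)=g(X_i)$ of either the repelling dynamics $$\frac{\partial u}{\partial t}(x,t)=\int_I W(x,y)\bigl(u(y,t)-u(x,t)\bigr)\,dy,\qquad \dot u^{(n)}_i(t)=\frac1n\sum_{j=1}^n A^{(n)}_{ij}\bigl(u^{(n)}_j(t)-u^{(n)}_i(t)\bigr),$$ or the opposing dynamics $$\frac{\partial u}{\partial t}(x,t)=\int_I W(x,y)u(y,t)\,dy-\int_I|W(x,y)|\,u(x,t)\,dy,\qquad \dot u^{(n)}_i(t)=\frac1n\Bigl(\sum_{j=1}^n A^{(n)}_{ij}u^{(n)}_j(t)-\sum_{j=1}^n|A^{(n)}_{ij}|\,u^{(n)}_i(t)\Bigr),$$ and put $u_n(x,t)=u^{(n)}_i(t)$ for $x\in(\frac{i-1}n,\frac in]$. Then, in each of the two cases, for every fixed $T>0$, almost surely $$\max_{t\in[0,T]}\|u_n(\cdot,t)-u(\cdot,t)\|_{L^2(I)}\to0\qquad(n\to\infty).$$ -/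

import Mathlib

open MeasureTheory ProbabilityTheory Set Filter Topology
open scoped ENNReal

noncomputable section

namespace SignedGraphon

/-- A (signed) graphon: a symmetric measurable function `[0,1]² → [-1,1]`. -/
structure IsGraphon (W : unitInterval → unitInterval → ℝ) : Prop where
  measurable : Measurable (Function.uncurry W)
  symm : ∀ x y, W x y = W y x
  abs_le_one : ∀ x y, |W x y| ≤ 1

/-- Piecewise Lipschitz: there are finitely many breakpoints `0 = α₀ < α₁ < ⋯ < α_{K+1} = 1` and a
constant `L` such that `W` is `L`-Lipschitz (for the `ℓ¹` distance) on every product of two open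
pieces. Nothing is required on the breakpoint lines, so it does not matter to which of the two
neighbouring pieces a breakpoint belongs. -/
def IsPiecewiseLipschitz (W : unitInterval → unitInterval → ℝ) : Prop :=
  ∃ (K : ℕ) (α : Fin (K + 2) → ℝ) (L : ℝ),
    StrictMono α ∧ α 0 = 0 ∧ α (Fin.last (K + 1)) = 1 ∧
    ∀ (k l : Fin (K + 1)) (x x' y y' : unitInterval),
      (x : ℝ) ∈ Ioo (α k.castSucc) (α k.succ) → (x' : ℝ) ∈ Ioo (α k.castSucc) (α k.succ) →
      (y : ℝ) ∈ Ioo (α l.castSucc) (α l.succ) → (y' : ℝ) ∈ Ioo (α l.castSucc) (α l.succ) →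
      |W x y - W x' y'| ≤ L * (|(x : ℝ) - x'| + |(y : ℝ) - y'|)

/-! ### Latent variables (the node `i : Fin n` is the `(i+1)`-st node) -/

/-- Deterministic latent variables: the `n` points `1/n, 2/n, …, n/n`. -/
def IsDeterministicLatent {Ω : Type*} {n : ℕ} (X : Ω → Fin n → unitInterval) : Prop :=
  ∀ ω i, (X ω i : ℝ) = (((i : ℕ) : ℝ) + 1) / n

/-- Stochastic latent variables: the order statistics of `n` independent random variables that are
uniformly distributed in `[0,1]`. -/
def IsStochasticLatent {Ω : Type*} [MeasurableSpace Ω] (P : Measure Ω) {n : ℕ}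
    (X : Ω → Fin n → unitInterval) : Prop :=
  ∃ U : Fin n → Ω → unitInterval,
    (∀ i, Measurable (U i)) ∧ (∀ i, P.map (U i) = volume) ∧ iIndepFun U P ∧
    ∀ ω i, X ω i = U (Tuple.sort (fun j => U j ω) i) ω

/-! ### Sampled signed graphs -/

/-- Unordered pairs of distinct nodes, written as ordered pairs `i < j`. -/
abbrev Pair (n : ℕ) : Type := {p : Fin n × Fin n // p.1 < p.2}

/-- Conditionally on the points `X`, the variables `η_{ij}`, `i < j`, are independent and `η_{ij}`
is Bernoulli with parameter `|W(X_i, X_j)|`: for each pattern `e` of zeros and ones,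
`P(η = e | X) = ∏_{i<j} |W(X_i,X_j)|^{e_{ij}} (1 - |W(X_i,X_j)|)^{1 - e_{ij}}`. -/
def IsCondBernoulli {Ω : Type*} [MeasurableSpace Ω] (P : Measure Ω)
    (W : unitInterval → unitInterval → ℝ) {n : ℕ} (X : Ω → Fin n → unitInterval)
    (η : Pair n → Ω → Bool) : Prop :=
  (∀ p, Measurable (η p)) ∧
  ∀ (B : Set (Fin n → unitInterval)) (e : Pair n → Bool), MeasurableSet B →
    P {ω | X ω ∈ B ∧ ∀ p, η p ω = e p} =
      ∫⁻ ω in X ⁻¹' B, ∏ p : Pair n,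
        (if e p = true then ENNReal.ofReal |W (X ω p.1.1) (X ω p.1.2)|
          else ENNReal.ofReal (1 - |W (X ω p.1.1) (X ω p.1.2)|)) ∂P

/-- `A` is the adjacency matrix of a signed graph sampled from `W` at the points `X`: it is
symmetric with entries in `{-1, 0, 1}`, and `A_{ij} = sign (W(X_i,X_j)) η_{ij}` for `i < j`, with
`η` as in `IsCondBernoulli`. The sampling does not prescribe the diagonal, which may be any. -/
def IsSampledGraph {Ω : Type*} [MeasurableSpace Ω] (P : Measure Ω)
    (W : unitInterval → unitInterval → ℝ) {n : ℕ} (X : Ω → Fin n → unitInterval)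
    (A : Ω → Matrix (Fin n) (Fin n) ℝ) : Prop :=
  (∀ ω i j, A ω i j = A ω j i) ∧
  (∀ ω i j, A ω i j = -1 ∨ A ω i j = 0 ∨ A ω i j = 1) ∧
  ∃ η : Pair n → Ω → Bool, IsCondBernoulli P W X η ∧
    ∀ ω (p : Pair n), A ω p.1.1 p.1.2 =
      Real.sign (W (X ω p.1.1) (X ω p.1.2)) * (if η p ω = true then 1 else 0)

/-! ### Dynamics on graphs -/

/-- `v` solves the repelling dynamics on the graph with adjacency matrix `A` for all times `t ≥ 0`,
with initial opinions `g`. -/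
def IsRepellingGraphSolution {n : ℕ} (A : Matrix (Fin n) (Fin n) ℝ) (g : Fin n → ℝ)
    (v : ℝ → Fin n → ℝ) : Prop :=
  (∀ i, v 0 i = g i) ∧
  ∀ t, 0 ≤ t → ∀ i, HasDerivWithinAt (fun s => v s i)
    (1 / (n : ℝ) * ∑ j, A i j * (v t j - v t i)) (Ici 0) t

/-- `v` solves the opposing dynamics on the graph with adjacency matrix `A` for all times `t ≥ 0`,
with initial opinions `g`. -/
def IsOpposingGraphSolution {n : ℕ} (A : Matrix (Fin n) (Fin n) ℝ) (g : Fin n → ℝ)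
    (v : ℝ → Fin n → ℝ) : Prop :=
  (∀ i, v 0 i = g i) ∧
  ∀ t, 0 ≤ t → ∀ i, HasDerivWithinAt (fun s => v s i)
    (1 / (n : ℝ) * ((∑ j, A i j * v t j) - ∑ j, |A i j| * v t i)) (Ici 0) t

/-- The piecewise constant function on `[0,1]` that is `a i` on the `(i+1)`-st interval
`(i/n, (i+1)/n]`. -/
def stepFunction {n : ℕ} (a : Fin n → ℝ) (x : unitInterval) : ℝ :=
  ∑ i : Fin n, indicator
    {z : unitInterval | ((i : ℕ) : ℝ) / n < (z : ℝ) ∧ (z : ℝ) ≤ (((i : ℕ) : ℝ) + 1) / n}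
    (fun _ => a i) x

/-! ### Dynamics on graphons -/

/-- `u ∈ C¹([0,∞); L^∞[0,1])` solves the repelling dynamics on `W` with initial opinions `g`. -/
def IsRepellingGraphonSolution (W : unitInterval → unitInterval → ℝ) (g : unitInterval → ℝ)
    (u : ℝ → Lp ℝ ∞ (volume : Measure unitInterval)) : Prop :=
  ContDiffOn ℝ 1 u (Ici 0) ∧ (u 0 =ᵐ[volume] g) ∧
  ∀ t, 0 ≤ t → (derivWithin u (Ici 0) t : Lp ℝ ∞ (volume : Measure unitInterval)) =ᵐ[volume]
    fun x => ∫ y, W x y * (u t y - u t x)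

/-- `u ∈ C¹([0,∞); L^∞[0,1])` solves the opposing dynamics on `W` with initial opinions `g`. -/
def IsOpposingGraphonSolution (W : unitInterval → unitInterval → ℝ) (g : unitInterval → ℝ)
    (u : ℝ → Lp ℝ ∞ (volume : Measure unitInterval)) : Prop :=
  ContDiffOn ℝ 1 u (Ici 0) ∧ (u 0 =ᵐ[volume] g) ∧
  ∀ t, 0 ≤ t → (derivWithin u (Ici 0) t : Lp ℝ ∞ (volume : Measure unitInterval)) =ᵐ[volume]
    fun x => (∫ y, W x y * u t y) - ∫ y, |W x y| * u t x

/-- `max_{t ∈ [0,T]} ‖u_n(·,t) - u(·,t)‖₂` exists for each `n` and tends to `0` as `n → ∞`, where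
`u_n(·,t)` is the step function of `v n t`. -/
def MaxErrorTendsToZero (T : ℝ) (v : (n : ℕ) → ℝ → Fin n → ℝ)
    (u : ℝ → Lp ℝ ∞ (volume : Measure unitInterval)) : Prop :=
  ∃ M : ℕ → ℝ≥0∞,
    (∀ n, IsGreatest
      ((fun t => eLpNorm (fun x => stepFunction (v n t) x - u t x) 2 volume) '' Icc 0 T) (M n)) ∧
    Tendsto M atTop (𝓝 0)

end SignedGraphon

end

/-! Both dynamics are linear flows in $L^2(I)$ with the same shape of generator: `drift V D` sends
$f$ to $\int V(x,y)f(y)\,dy-\bigl(\int D(x,y)\,dy\bigr)f(x)$. Repelling is $D=V$, opposing is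
$D=|V|$. Step functions are invariant under the generator of a step kernel, so the graph dynamics is
such a flow as well (`kernelOp_stepLp`), and every generator has norm at most $2$.

For uniformly bounded generators, strong convergence along the limiting trajectory suffices: on
$[0,T]$ the trajectory is compact, so the convergence is uniform on it, and Grönwall's inequality
bounds the error (`exists_isGreatest_norm_sub_of_flow`). No convergence in operator norm or cut norm
is needed.

Strong convergence at a fixed bounded $f$ has two sources (`ae_tendsto_kernelOp`). Replacing
$A_{ij}$ by its conditional mean $W(X_i,X_j)$ costs a row average with nonrandom weights, the cell
averages of $f$. A Chernoff bound conditional on $X$, a union bound over the $n$ rows and the first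
Borel–Cantelli lemma make this cost vanish uniformly in $i$, whatever the joint law over $n$. Next,
$W(X_i,X_j)$ tends to $W(x,y)$ for almost every $(x,y)$: the latent variable of the cell around $x$
tends to $x$, by Hoeffding's inequality for the empirical distribution function in the stochastic
case, and $W$ is continuous off a null set of lines. Dominated convergence does the rest.

The exceptional null set depends on $f$. It is enough to take $f=u(\cdot,q)$ for rational $q\ge0$,
since these are dense in the trajectory and strong convergence of uniformly bounded operators passes
to closures. -/

noncomputable section

namespace SignedGraphon

/-! ### Strong convergence of operators and linear flows -/

section Flow

variable {E : Type*} [NormedAddCommGroup E] [NormedSpace ℝ E]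

/-- Strong convergence of uniformly bounded operators extends from a set to its closure. -/
theorem tendsto_apply_of_mem_closure {B : ℕ → E →L[ℝ] E} {B' : E →L[ℝ] E} {C : ℝ}
    (hB : ∀ n, ‖B n‖ ≤ C) {D : Set E} (h : ∀ x ∈ D, Tendsto (fun n => B n x) atTop (𝓝 (B' x)))
    {x : E} (hx : x ∈ closure D) : Tendsto (fun n => B n x) atTop (𝓝 (B' x)) := by
  have hC : 0 ≤ C := (norm_nonneg _).trans (hB 0)
  have hpos : 0 < C + ‖B'‖ + 1 := by positivity
  rw [Metric.tendsto_atTop]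
  intro ε hε
  -- With this radius, moving from `x` to `y` costs at most $(C+\|B'\|)\|x-y\|<\varepsilon/2$.
  obtain ⟨y, hy, hxy⟩ := Metric.mem_closure_iff.1 hx (ε / 2 / (C + ‖B'‖ + 1)) (by positivity)
  obtain ⟨N, hN⟩ := Metric.tendsto_atTop.1 (h y hy) (ε / 2) (by positivity)
  refine ⟨N, fun n hn => ?_⟩
  have h1 := hN n hn
  rw [dist_eq_norm] at h1 hxy ⊢
  rw [lt_div_iff₀ hpos] at hxy
  have h2 : B n x - B' x = B n (x - y) - B' (x - y) + (B n y - B' y) := by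
    simp only [map_sub]; abel
  have h3 : ‖B n (x - y)‖ ≤ C * ‖x - y‖ := (B n).le_of_opNorm_le (hB n) _
  have h4 : ‖B' (x - y)‖ ≤ ‖B'‖ * ‖x - y‖ := B'.le_opNorm _
  have h5 := norm_nonneg (x - y)
  rw [h2]
  refine (norm_add_le _ _).trans_lt ?_
  have := norm_sub_le (B n (x - y)) (B' (x - y))
  nlinarith

/-- Strong convergence of uniformly bounded operators is uniform on compact sets. -/
theorem eventually_norm_sub_le_of_isCompact {B : ℕ → E →L[ℝ] E} {B' : E →L[ℝ] E} {C : ℝ}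
    (hB : ∀ n, ‖B n‖ ≤ C) {K : Set E} (hK : IsCompact K)
    (h : ∀ x ∈ K, Tendsto (fun n => B n x) atTop (𝓝 (B' x))) {ε : ℝ} (hε : 0 < ε) :
    ∀ᶠ n in atTop, ∀ x ∈ K, ‖B n x - B' x‖ ≤ ε := by
  have hC : 0 ≤ C := (norm_nonneg _).trans (hB 0)
  have hpos : 0 < C + ‖B'‖ + 1 := by positivity
  obtain ⟨t, htK, htf, ht⟩ := hK.finite_cover_balls
    (show 0 < ε / 2 / (C + ‖B'‖ + 1) by positivity)
  have hev : ∀ᶠ n in atTop, ∀ y ∈ t, ‖B n y - B' y‖ < ε / 2 := by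
    rw [eventually_all_finite htf]
    intro y hy
    have := (h y (htK hy)).eventually (Metric.ball_mem_nhds _ (half_pos hε))
    simpa [dist_eq_norm] using this
  filter_upwards [hev] with n hn x hx
  obtain ⟨y, hy, hxy⟩ := mem_iUnion₂.1 (ht hx)
  rw [Metric.mem_ball, dist_eq_norm, lt_div_iff₀ hpos] at hxy
  have h1 := hn y hy
  have h2 : B n x - B' x = B n (x - y) - B' (x - y) + (B n y - B' y) := by
    simp only [map_sub]; abel
  have h3 : ‖B n (x - y)‖ ≤ C * ‖x - y‖ := (B n).le_of_opNorm_le (hB n) _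
  have h4 : ‖B' (x - y)‖ ≤ ‖B'‖ * ‖x - y‖ := B'.le_opNorm _
  have h5 := norm_nonneg (x - y)
  rw [h2]
  refine (norm_add_le _ _).trans ?_
  have := norm_sub_le (B n (x - y)) (B' (x - y))
  nlinarith

/-- If bounded operators converge strongly along the trajectory of the limiting linear flow, then
the trajectories converge uniformly on compact time intervals. -/
theorem exists_isGreatest_norm_sub_of_flow {B : ℕ → E →L[ℝ] E} {B' : E →L[ℝ] E} {C : ℝ}
    (hB : ∀ n, ‖B n‖ ≤ C) {s : ℕ → ℝ → E} {U : ℝ → E}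
    (hs : ∀ n t, 0 ≤ t → HasDerivWithinAt (s n) (B n (s n t)) (Ici 0) t)
    (hU : ∀ t, 0 ≤ t → HasDerivWithinAt U (B' (U t)) (Ici 0) t)
    (h0 : Tendsto (fun n => s n 0) atTop (𝓝 (U 0))) {T : ℝ} (hT : 0 ≤ T)
    (hconv : ∀ t ∈ Icc 0 T, Tendsto (fun n => B n (U t)) atTop (𝓝 (B' (U t)))) :
    ∃ M : ℕ → ℝ, (∀ n, IsGreatest ((fun t => ‖s n t - U t‖) '' Icc 0 T) (M n)) ∧
      Tendsto M atTop (𝓝 0) := by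
  have hC : 0 ≤ C := (norm_nonneg _).trans (hB 0)
  have hUc : ContinuousOn U (Icc 0 T) := fun t ht =>
    ((hU t ht.1).continuousWithinAt).mono Icc_subset_Ici_self
  have hsc : ∀ n, ContinuousOn (s n) (Icc 0 T) := fun n t ht =>
    ((hs n t ht.1).continuousWithinAt).mono Icc_subset_Ici_self
  have hmax : ∀ n, ∃ t ∈ Icc 0 T, IsMaxOn (fun t => ‖s n t - U t‖) (Icc 0 T) t := fun n =>
    isCompact_Icc.exists_isMaxOn ⟨0, le_rfl, hT⟩ ((hsc n).sub hUc).norm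
  choose t ht hmax using hmax
  refine ⟨fun n => ‖s n (t n) - U (t n)‖, fun n => ⟨⟨t n, ht n, rfl⟩, ?_⟩, ?_⟩
  · rintro _ ⟨r, hr, rfl⟩
    exact hmax n hr
  -- The rate is relaxed from `C` to `C + 1` so that it is nonzero and `gronwallBound` takes its
  -- exponential form.
  have hg : Tendsto (fun ε : ℝ => gronwallBound ε (C + 1) ε T) (𝓝 0) (𝓝 0) := by
    have hne : C + 1 ≠ 0 := by positivity
    have : Continuous fun ε : ℝ => gronwallBound ε (C + 1) ε T := by
      simp only [gronwallBound, if_neg hne]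
      fun_prop
    simpa [gronwallBound, if_neg hne] using this.tendsto 0
  rw [Metric.tendsto_atTop]
  intro ε hε
  obtain ⟨δ, hδ, hδε⟩ : ∃ δ > 0, gronwallBound δ (C + 1) δ T < ε := by
    have h1 : ∀ᶠ δ in 𝓝[>] (0 : ℝ), gronwallBound δ (C + 1) δ T < ε :=
      (hg.mono_left nhdsWithin_le_nhds).eventually (gt_mem_nhds hε)
    obtain ⟨δ, h2, h3⟩ := (h1.and self_mem_nhdsWithin).exists
    exact ⟨δ, h3, h2⟩
  have hunif := eventually_norm_sub_le_of_isCompact hB (isCompact_Icc.image_of_continuousOn hUc)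
    (by rintro _ ⟨r, hr, rfl⟩; exact hconv r hr) hδ
  have hinit : ∀ᶠ n in atTop, ‖s n 0 - U 0‖ < δ := by
    have := h0.eventually (Metric.ball_mem_nhds _ hδ)
    simpa [dist_eq_norm] using this
  obtain ⟨N, hN⟩ := eventually_atTop.1 (hunif.and hinit)
  refine ⟨N, fun n hn => ?_⟩
  obtain ⟨hn1, hn2⟩ := hN n hn
  -- The error solves $e'=B_ne+(B_n-B')U$: the first term gives the rate, and the forcing term is at
  -- most $\delta$ because it involves only the limiting trajectory.
  have hgr := norm_le_gronwallBound_of_norm_deriv_right_le (f := fun r => s n r - U r)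
    (f' := fun r => B n (s n r) - B' (U r)) (δ := δ) (K := C + 1) (ε := δ) (a := 0) (b := T)
    ((hsc n).sub hUc)
    (fun r hr => ((hs n r hr.1).sub (hU r hr.1)).mono (Ici_subset_Ici.2 hr.1)) hn2.le
    (fun r hr => by
      have h1 : B n (s n r) - B' (U r) = B n (s n r - U r) + (B n (U r) - B' (U r)) := by
        simp only [map_sub]; abel
      have h2 : ‖B n (s n r - U r)‖ ≤ C * ‖s n r - U r‖ := (B n).le_of_opNorm_le (hB n) _
      have h3 := hn1 _ ⟨r, ⟨hr.1, hr.2.le⟩, rfl⟩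
      have h4 := norm_nonneg (s n r - U r)
      rw [h1]
      refine (norm_add_le _ _).trans ?_
      linarith) (t n) (ht n)
  rw [Real.dist_0_eq_abs, abs_of_nonneg (norm_nonneg _)]
  refine hgr.trans_lt (lt_of_le_of_lt ?_ hδε)
  exact gronwallBound_mono hδ.le hδ.le (by positivity) (by simpa using (ht n).2)

end Flow

/-! ### Step functions -/

/-- The `i`-th interval `(i/n, (i+1)/n]`. -/
def cell {n : ℕ} (i : Fin n) : Set unitInterval :=
  {z : unitInterval | ((i : ℕ) : ℝ) / n < (z : ℝ) ∧ (z : ℝ) ≤ (((i : ℕ) : ℝ) + 1) / n}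

theorem stepFunction_eq_sum {n : ℕ} (a : Fin n → ℝ) (x : unitInterval) :
    stepFunction a x = ∑ i, indicator (cell i) (fun _ => a i) x := rfl

theorem natCast_pos_of_fin {n : ℕ} (i : Fin n) : (0 : ℝ) < n :=
  Nat.cast_pos.2 (lt_of_le_of_lt (Nat.zero_le _) i.2)

theorem mem_cell_iff {n : ℕ} (i : Fin n) (x : unitInterval) :
    x ∈ cell i ↔ ((i : ℕ) : ℝ) < n * x ∧ n * (x : ℝ) ≤ (i : ℕ) + 1 := by
  have h := natCast_pos_of_fin i
  simp only [cell, mem_ofPred_eq, div_lt_iff₀ h, le_div_iff₀ h, mul_comm (x : ℝ)]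

theorem measurableSet_cell {n : ℕ} (i : Fin n) : MeasurableSet (cell i) :=
  (measurableSet_lt measurable_const measurable_subtype_coe).inter
    (measurableSet_le measurable_subtype_coe measurable_const)

theorem volume_cell {n : ℕ} (i : Fin n) :
    (volume : Measure unitInterval) (cell i) = ENNReal.ofReal (1 / n) := by
  have h := natCast_pos_of_fin i
  have hi : ((i : ℕ) : ℝ) + 1 ≤ n := by exact_mod_cast i.2
  have h1 : ((i : ℕ) : ℝ) / n ∈ unitInterval :=
    ⟨by positivity, (div_le_one h).2 (by linarith)⟩
  have h2 : (((i : ℕ) : ℝ) + 1) / n ∈ unitInterval :=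
    ⟨by positivity, (div_le_one h).2 hi⟩
  have h3 : cell i = Ioc (⟨_, h1⟩ : unitInterval) ⟨_, h2⟩ := rfl
  rw [h3, unitInterval.volume_Ioc]
  congr 1
  simp only
  ring

theorem measureReal_cell {n : ℕ} (i : Fin n) :
    (volume : Measure unitInterval).real (cell i) = 1 / n := by
  rw [measureReal_def, volume_cell, ENNReal.toReal_ofReal (by positivity)]

theorem eq_of_mem_cell {n : ℕ} {i j : Fin n} {x : unitInterval} (hi : x ∈ cell i)
    (hj : x ∈ cell j) : i = j := by
  rw [mem_cell_iff] at hi hj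
  have h1 : ((i : ℕ) : ℝ) < (j : ℕ) + 1 := hi.1.trans_le hj.2
  have h2 : ((j : ℕ) : ℝ) < (i : ℕ) + 1 := hj.1.trans_le hi.2
  norm_cast at h1 h2
  exact Fin.ext (by omega)

theorem exists_mem_cell {n : ℕ} (hn : 0 < n) {x : unitInterval} (hx : 0 < (x : ℝ)) :
    ∃ i : Fin n, x ∈ cell i := by
  have hn' : (0 : ℝ) < n := Nat.cast_pos.2 hn
  have hpos : 0 < (n : ℝ) * x := by positivity
  -- Cells are open on the left and indexed from zero, so the index of the cell of `x` is $\lceil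
  -- nx\rceil-1$.
  have hc : 0 < ⌈(n : ℝ) * x⌉₊ := Nat.ceil_pos.2 hpos
  have hle : ⌈(n : ℝ) * x⌉₊ ≤ n := Nat.ceil_le.2 (by
    have := x.2.2
    nlinarith)
  refine ⟨⟨⌈(n : ℝ) * x⌉₊ - 1, by omega⟩, (mem_cell_iff _ _).2 ⟨?_, ?_⟩⟩
  · have := Nat.ceil_lt_add_one hpos.le
    simp only
    rw [Nat.cast_sub hc]
    push_cast
    linarith
  · have := Nat.le_ceil ((n : ℝ) * x)
    simp only
    rw [Nat.cast_sub hc]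
    push_cast
    linarith

theorem stepFunction_of_mem {n : ℕ} (a : Fin n → ℝ) {i : Fin n} {x : unitInterval}
    (h : x ∈ cell i) : stepFunction a x = a i := by
  rw [stepFunction_eq_sum, Finset.sum_eq_single i]
  · simp [h]
  · intro j _ hj
    exact indicator_of_notMem (fun hx => hj (eq_of_mem_cell hx h)) _
  · simp

/-- Covers the points in no cell: $x=0$, and every point when $n=0$. -/
theorem stepFunction_of_forall_notMem {n : ℕ} (a : Fin n → ℝ) {x : unitInterval}
    (h : ∀ i : Fin n, x ∉ cell i) : stepFunction a x = 0 := by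
  rw [stepFunction_eq_sum]
  exact Finset.sum_eq_zero fun i _ => indicator_of_notMem (h i) _

theorem abs_stepFunction_le {n : ℕ} {a : Fin n → ℝ} {C : ℝ} (hC : 0 ≤ C) (ha : ∀ i, |a i| ≤ C)
    (x : unitInterval) : |stepFunction a x| ≤ C := by
  by_cases h : ∃ i : Fin n, x ∈ cell i
  · obtain ⟨i, hi⟩ := h
    rw [stepFunction_of_mem a hi]
    exact ha i
  · rw [stepFunction_of_forall_notMem a (not_exists.1 h)]
    simpa using hC

theorem measurable_stepFunction {n : ℕ} (a : Fin n → ℝ) : Measurable (stepFunction a) := by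
  have : stepFunction a = fun x => ∑ i, indicator (cell i) (fun _ => a i) x := rfl
  rw [this]
  exact Finset.measurable_sum _ fun i _ => measurable_const.indicator (measurableSet_cell i)

theorem exists_abs_stepFunction_le {n : ℕ} (a : Fin n → ℝ) :
    ∃ C, ∀ x, |stepFunction a x| ≤ C :=
  ⟨∑ i, |a i|, abs_stepFunction_le (Finset.sum_nonneg fun _ _ => abs_nonneg _) fun i =>
    Finset.single_le_sum (f := fun i => |a i|) (fun _ _ => abs_nonneg _) (Finset.mem_univ i)⟩

theorem integral_stepFunction_mul {n : ℕ} (a : Fin n → ℝ) {f : unitInterval → ℝ}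
    (hf : Integrable f) : ∫ y, stepFunction a y * f y = ∑ i, a i * ∫ y in cell i, f y := by
  have h1 : ∀ y, stepFunction a y * f y = ∑ i, a i * indicator (cell i) f y := by
    intro y
    rw [stepFunction_eq_sum, Finset.sum_mul]
    refine Finset.sum_congr rfl fun i _ => ?_
    by_cases h : y ∈ cell i <;> simp [h]
  simp_rw [h1]
  rw [integral_finsetSum _ fun i _ => (hf.indicator (measurableSet_cell i)).const_mul _]
  refine Finset.sum_congr rfl fun i _ => ?_
  rw [integral_const_mul, integral_indicator (measurableSet_cell i)]

theorem integral_stepFunction {n : ℕ} (a : Fin n → ℝ) :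
    ∫ y, stepFunction a y = 1 / n * ∑ i, a i := by
  have := integral_stepFunction_mul a (integrable_const (1 : ℝ))
  simp only [mul_one] at this
  rw [this, Finset.mul_sum]
  refine Finset.sum_congr rfl fun i _ => ?_
  rw [setIntegral_const, measureReal_cell, smul_eq_mul, mul_one, mul_comm]

theorem stepFunction_mul {n : ℕ} (a b : Fin n → ℝ) (x : unitInterval) :
    stepFunction a x * stepFunction b x = stepFunction (fun i => a i * b i) x := by
  by_cases h : ∃ i : Fin n, x ∈ cell i
  · obtain ⟨i, hi⟩ := h
    simp only [stepFunction_of_mem _ hi]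
  · simp only [stepFunction_of_forall_notMem _ (not_exists.1 h), mul_zero]

/-- The piecewise constant kernel on `[0,1]²` of a square matrix. -/
def stepKernel {n : ℕ} (A : Matrix (Fin n) (Fin n) ℝ) (x y : unitInterval) : ℝ :=
  stepFunction (fun i => stepFunction (A i) y) x

theorem stepKernel_of_mem {n : ℕ} (A : Matrix (Fin n) (Fin n) ℝ) {i : Fin n} {x : unitInterval}
    (h : x ∈ cell i) (y : unitInterval) : stepKernel A x y = stepFunction (A i) y :=
  stepFunction_of_mem _ h

/-! ### Kernel operators on `L²` -/

/-- Measurable kernels with values in `[-1,1]`. -/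
structure IsKernel (V : unitInterval → unitInterval → ℝ) : Prop where
  measurable : Measurable (Function.uncurry V)
  abs_le_one : ∀ x y, |V x y| ≤ 1

theorem IsGraphon.isKernel {W : unitInterval → unitInterval → ℝ} (h : IsGraphon W) :
    IsKernel W := ⟨h.measurable, h.abs_le_one⟩

theorem isKernel_stepKernel {n : ℕ} {A : Matrix (Fin n) (Fin n) ℝ} (hA : ∀ i j, |A i j| ≤ 1) :
    IsKernel (stepKernel A) where
  measurable := by
    have : Function.uncurry (stepKernel A) = fun p : unitInterval × unitInterval =>
        ∑ i, indicator (Prod.fst ⁻¹' cell i) (fun p => stepFunction (A i) p.2) p := by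
      ext ⟨x, y⟩
      simp only [Function.uncurry, stepKernel, stepFunction_eq_sum (fun i => stepFunction (A i) y)]
      rfl
    rw [this]
    exact Finset.measurable_sum _ fun i _ =>
      ((measurable_stepFunction _).comp measurable_snd).indicator
        (measurable_fst (measurableSet_cell i))
  abs_le_one x y := abs_stepFunction_le zero_le_one
    (fun i => abs_stepFunction_le zero_le_one (hA i) y) x

section KernelOp

variable {V D : unitInterval → unitInterval → ℝ}

theorem IsKernel.measurable_right (hV : IsKernel V) (x : unitInterval) : Measurable (V x) :=
  hV.measurable.comp measurable_prodMk_left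

theorem IsKernel.integrable_mul (hV : IsKernel V) {f : unitInterval → ℝ} (hf : Integrable f)
    (x : unitInterval) : Integrable fun y => V x y * f y :=
  hf.bdd_mul (hV.measurable_right x).aestronglyMeasurable
    (Eventually.of_forall fun y => by simpa using hV.abs_le_one x y)

theorem IsKernel.integrable (hV : IsKernel V) (x : unitInterval) : Integrable (V x) := by
  simpa using hV.integrable_mul (integrable_const (1 : ℝ)) x

theorem IsKernel.aestronglyMeasurable_integral_mul (hV : IsKernel V) {f : unitInterval → ℝ}
    (hf : AEStronglyMeasurable f) :
    AEStronglyMeasurable fun x => ∫ y, V x y * f y := by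
  have h1 : (fun x => ∫ y, V x y * f y) = fun x => ∫ y, V x y * hf.mk f y := by
    ext x
    refine integral_congr_ae ?_
    filter_upwards [hf.ae_eq_mk] with y hy
    rw [hy]
  rw [h1]
  have h2 : StronglyMeasurable (Function.uncurry fun x y => V x y * hf.mk f y) :=
    hV.measurable.stronglyMeasurable.mul (hf.stronglyMeasurable_mk.comp_measurable measurable_snd)
  exact h2.integral_prod_right.aestronglyMeasurable

theorem IsKernel.abs_integral_mul_le (hV : IsKernel V) {f : unitInterval → ℝ}
    (hf : Integrable f) (x : unitInterval) : |∫ y, V x y * f y| ≤ ∫ y, |f y| := by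
  refine (abs_integral_le_integral_abs).trans ?_
  refine integral_mono (hV.integrable_mul hf x).abs hf.abs fun y => ?_
  simp only [abs_mul]
  exact mul_le_of_le_one_left (abs_nonneg _) (hV.abs_le_one x y)

theorem IsKernel.abs_integral_le (hV : IsKernel V) (x : unitInterval) : |∫ y, V x y| ≤ 1 := by
  simpa using hV.abs_integral_mul_le (integrable_const (1 : ℝ)) x

theorem IsKernel.aestronglyMeasurable_integral (hV : IsKernel V) :
    AEStronglyMeasurable fun x => ∫ y, V x y := by
  simpa using hV.aestronglyMeasurable_integral_mul
    (aestronglyMeasurable_const (b := (1 : ℝ)) (μ := (volume : Measure unitInterval)))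

/-- The right-hand side of the dynamics with interaction kernel `V` and decay kernel `D`. -/
def drift (V D : unitInterval → unitInterval → ℝ) (f : unitInterval → ℝ) (x : unitInterval) : ℝ :=
  (∫ y, V x y * f y) - (∫ y, D x y) * f x

/-- Makes `drift` well defined on classes of functions, hence an operator on $L^2$. -/
theorem drift_congr_ae {f f' : unitInterval → ℝ} (h : f =ᵐ[volume] f') :
    drift V D f =ᵐ[volume] drift V D f' := by
  filter_upwards [h] with x hx
  have : ∀ x, ∫ y, V x y * f y = ∫ y, V x y * f' y := fun x => by
    refine integral_congr_ae ?_
    filter_upwards [h] with y hy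
    rw [hy]
  rw [drift, drift, hx, this]

theorem memLp_integral_mul (hV : IsKernel V) {f : unitInterval → ℝ} (hf : MemLp f 2 volume) :
    MemLp (fun x => ∫ y, V x y * f y) 2 volume :=
  MemLp.of_bound (hV.aestronglyMeasurable_integral_mul hf.1) (∫ y, |f y|)
    (Eventually.of_forall fun x => hV.abs_integral_mul_le (hf.integrable one_le_two) x)

theorem memLp_integral_smul (hD : IsKernel D) {f : unitInterval → ℝ} (hf : MemLp f 2 volume) :
    MemLp (fun x => (∫ y, D x y) * f x) 2 volume :=
  hf.mono (hD.aestronglyMeasurable_integral.mul hf.1) (Eventually.of_forall fun x => by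
    rw [norm_mul]
    exact mul_le_of_le_one_left (norm_nonneg _) (hD.abs_integral_le x))

theorem memLp_drift (hV : IsKernel V) (hD : IsKernel D) {f : unitInterval → ℝ}
    (hf : MemLp f 2 volume) : MemLp (drift V D f) 2 volume :=
  (memLp_integral_mul hV hf).sub (memLp_integral_smul hD hf)

/-- Each of the two terms has norm at most $\|f\|_2$. For the integral term, the kernel bound gives
$L^1\to L^\infty$ with norm one, and on a probability space $\|\cdot\|_2\le\|\cdot\|_\infty$ and
$\|\cdot\|_1\le\|\cdot\|_2$. -/
theorem eLpNorm_drift_le (hV : IsKernel V) (hD : IsKernel D) {f : unitInterval → ℝ}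
    (hf : MemLp f 2 volume) : eLpNorm (drift V D f) 2 volume ≤ 2 * eLpNorm f 2 volume := by
  have h1 : eLpNorm (fun x => ∫ y, V x y * f y) 2 volume ≤ eLpNorm f 2 volume := by
    have hb := eLpNorm_le_of_ae_bound (p := 2) (μ := (volume : Measure unitInterval))
      (f := fun x => ∫ y, V x y * f y) (C := ∫ y, |f y|)
      (Eventually.of_forall fun x => hV.abs_integral_mul_le (hf.integrable one_le_two) x)
    simp only [measure_univ, ENNReal.one_rpow, one_mul] at hb
    refine hb.trans (le_trans (le_of_eq ?_)
      (eLpNorm_le_eLpNorm_of_exponent_le (p := 1) one_le_two hf.1))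
    rw [eLpNorm_one_eq_lintegral_enorm,
      ← ofReal_integral_norm_eq_lintegral_enorm (hf.integrable one_le_two)]
    rfl
  have h2 : eLpNorm (fun x => (∫ y, D x y) * f x) 2 volume ≤ eLpNorm f 2 volume :=
    eLpNorm_mono fun x => by
      rw [norm_mul]
      exact mul_le_of_le_one_left (norm_nonneg _) (hD.abs_integral_le x)
  refine (eLpNorm_sub_le (memLp_integral_mul hV hf).1 (memLp_integral_smul hD hf).1
    one_le_two).trans ?_
  rw [two_mul]
  exact add_le_add h1 h2

theorem drift_add (hV : IsKernel V) {f f' : unitInterval → ℝ} (hf : Integrable f)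
    (hf' : Integrable f') (x : unitInterval) :
    drift V D (f + f') x = drift V D f x + drift V D f' x := by
  simp only [drift, Pi.add_apply, mul_add]
  rw [integral_add (hV.integrable_mul hf x) (hV.integrable_mul hf' x)]
  ring

theorem drift_smul (c : ℝ) (f : unitInterval → ℝ) (x : unitInterval) :
    drift V D (c • f) x = c * drift V D f x := by
  simp only [drift, Pi.smul_apply, smul_eq_mul, mul_left_comm _ c, integral_const_mul]
  ring

/-- `drift` as a bounded operator on `L²`. -/
def kernelOp (hV : IsKernel V) (hD : IsKernel D) :
    Lp ℝ 2 (volume : Measure unitInterval) →L[ℝ] Lp ℝ 2 (volume : Measure unitInterval) :=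
  LinearMap.mkContinuous
    { toFun := fun f => (memLp_drift hV hD (Lp.memLp f)).toLp _
      map_add' := fun f f' => by
        rw [← MemLp.toLp_add]
        refine MemLp.toLp_congr _ _ ?_
        refine (drift_congr_ae (Lp.coeFn_add f f')).trans (Eventually.of_forall fun x => ?_)
        exact drift_add hV ((Lp.memLp f).integrable one_le_two)
          ((Lp.memLp f').integrable one_le_two) x
      map_smul' := fun c f => by
        rw [RingHom.id_apply, ← MemLp.toLp_const_smul]
        refine MemLp.toLp_congr _ _ ?_
        refine (drift_congr_ae (Lp.coeFn_smul c f)).trans (Eventually.of_forall fun x => ?_)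
        exact drift_smul c f x } 2
    (fun f => by
      simp only [LinearMap.coe_mk, AddHom.coe_mk]
      rw [Lp.norm_toLp, Lp.norm_def]
      have h := eLpNorm_drift_le hV hD (Lp.memLp f)
      have h2 := ENNReal.toReal_mono (ENNReal.mul_ne_top ENNReal.ofNat_ne_top
        (Lp.memLp f).eLpNorm_ne_top) h
      simpa using h2)

theorem coeFn_kernelOp (hV : IsKernel V) (hD : IsKernel D)
    (f : Lp ℝ 2 (volume : Measure unitInterval)) :
    kernelOp hV hD f =ᵐ[volume] drift V D f :=
  (memLp_drift hV hD (Lp.memLp f)).coeFn_toLp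

theorem norm_kernelOp_le (hV : IsKernel V) (hD : IsKernel D) : ‖kernelOp hV hD‖ ≤ 2 :=
  LinearMap.mkContinuous_norm_le _ zero_le_two _

end KernelOp

/-! ### Embeddings into `L²` -/

theorem memLp_stepFunction {n : ℕ} (a : Fin n → ℝ) (p : ℝ≥0∞) :
    MemLp (stepFunction a) p (volume : Measure unitInterval) := by
  obtain ⟨C, hC⟩ := exists_abs_stepFunction_le a
  exact MemLp.of_bound (measurable_stepFunction a).aestronglyMeasurable C (Eventually.of_forall hC)

/-- Vectors as step functions in `L²`. -/
def stepLp (n : ℕ) : (Fin n → ℝ) →L[ℝ] Lp ℝ 2 (volume : Measure unitInterval) :=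
  LinearMap.toContinuousLinearMap
    { toFun := fun a => (memLp_stepFunction a 2).toLp _
      map_add' := fun a b => by
        rw [← MemLp.toLp_add]
        refine MemLp.toLp_congr _ _ (Eventually.of_forall fun x => ?_)
        simp only [stepFunction_eq_sum, Pi.add_apply, ← Finset.sum_add_distrib]
        exact Finset.sum_congr rfl fun i _ => congrFun (indicator_add _ _ _) _
      map_smul' := fun c a => by
        rw [RingHom.id_apply, ← MemLp.toLp_const_smul]
        refine MemLp.toLp_congr _ _ (Eventually.of_forall fun x => ?_)
        simp only [stepFunction_eq_sum, Pi.smul_apply, Finset.smul_sum]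
        exact Finset.sum_congr rfl fun i _ => indicator_const_smul_apply _ _ _ _ }

theorem coeFn_stepLp {n : ℕ} (a : Fin n → ℝ) : stepLp n a =ᵐ[volume] stepFunction a :=
  (memLp_stepFunction a 2).coeFn_toLp

/-- The inclusion of `L^∞` into `L²`. -/
def toL2 : Lp ℝ ∞ (volume : Measure unitInterval) →L[ℝ] Lp ℝ 2 (volume : Measure unitInterval) :=
  LinearMap.mkContinuous
    { toFun := fun f => ((Lp.memLp f).mono_exponent le_top).toLp f
      map_add' := fun f f' => by
        rw [← MemLp.toLp_add]
        exact MemLp.toLp_congr _ _ (Lp.coeFn_add f f')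
      map_smul' := fun c f => by
        rw [RingHom.id_apply, ← MemLp.toLp_const_smul]
        exact MemLp.toLp_congr _ _ (Lp.coeFn_smul c f) } 1
    (fun f => by
      simp only [LinearMap.coe_mk, AddHom.coe_mk, one_mul]
      rw [Lp.norm_toLp, Lp.norm_def]
      exact ENNReal.toReal_mono (Lp.memLp f).eLpNorm_ne_top
        (eLpNorm_le_eLpNorm_of_exponent_le le_top (Lp.aestronglyMeasurable f)))

theorem coeFn_toL2 (f : Lp ℝ ∞ (volume : Measure unitInterval)) : toL2 f =ᵐ[volume] f :=
  ((Lp.memLp f).mono_exponent le_top).coeFn_toLp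

/-- The right-hand side of the dynamics on a graph with interaction matrix `A` and decay
matrix `A'`. -/
def graphDrift {n : ℕ} (A A' : Matrix (Fin n) (Fin n) ℝ) (a : Fin n → ℝ) (i : Fin n) : ℝ :=
  1 / (n : ℝ) * ∑ j, A i j * a j - (1 / (n : ℝ) * ∑ j, A' i j) * a i

/-- On the cell of `i` the step kernel is the step function of row `i`, and the integral of a step
function is the average of its values. This turns the finite system into a flow in $L^2$. -/
theorem kernelOp_stepLp {n : ℕ} {A A' : Matrix (Fin n) (Fin n) ℝ} (hA : ∀ i j, |A i j| ≤ 1)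
    (hA' : ∀ i j, |A' i j| ≤ 1) (a : Fin n → ℝ) :
    kernelOp (isKernel_stepKernel hA) (isKernel_stepKernel hA') (stepLp n a) =
      stepLp n (graphDrift A A' a) := by
  refine Lp.ext ?_
  refine (coeFn_kernelOp _ _ _).trans ((drift_congr_ae (coeFn_stepLp a)).trans ?_)
  refine EventuallyEq.trans (Eventually.of_forall fun x => ?_) (coeFn_stepLp _).symm
  by_cases h : ∃ i : Fin n, x ∈ cell i
  · obtain ⟨i, hi⟩ := h
    simp only [drift, stepKernel_of_mem _ hi, stepFunction_of_mem _ hi, stepFunction_mul,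
      integral_stepFunction, graphDrift]
  · have h' := not_exists.1 h
    simp only [drift, stepKernel, stepFunction_of_forall_notMem _ h']
    simp

/-! ### Concentration for sampled graphs -/

section Bernoulli

/-- A convex function lies below its chord over $[-1,1]$; this is the core of Hoeffding's lemma. -/
theorem exp_mul_le_of_abs_le_one (k : ℝ) {z : ℝ} (hz : |z| ≤ 1) :
    Real.exp (k * z) ≤ (1 + z) / 2 * Real.exp k + (1 - z) / 2 * Real.exp (-k) := by
  obtain ⟨h1, h2⟩ := abs_le.1 hz
  have := convexOn_exp.2 (mem_univ k) (mem_univ (-k))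
    (show 0 ≤ (1 + z) / 2 by linarith) (show 0 ≤ (1 - z) / 2 by linarith) (by ring)
  simp only [smul_eq_mul] at this
  refine le_trans (le_of_eq ?_) this
  congr 1
  ring

theorem sign_mul_abs (w : ℝ) : Real.sign w * |w| = w := by
  rcases lt_trichotomy w 0 with h | h | h
  · rw [Real.sign_of_neg h, abs_of_neg h]; ring
  · simp [h]
  · rw [Real.sign_of_pos h, abs_of_pos h]; ring

theorem abs_sign_sub_le_one {w : ℝ} (hw : |w| ≤ 1) : |Real.sign w - w| ≤ 1 := by
  obtain ⟨h1, h2⟩ := abs_le.1 hw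
  rw [abs_le]
  rcases lt_trichotomy w 0 with h | h | h
  · rw [Real.sign_of_neg h]; constructor <;> linarith
  · simp [h]
  · rw [Real.sign_of_pos h]; constructor <;> linarith

/-- The weight of the outcome `b` under the Bernoulli distribution with parameter `|w|`. -/
def bernoulliWeight (w : ℝ) (b : Bool) : ℝ := if b = true then |w| else 1 - |w|

/-- The deviation of the signed Bernoulli variable with mean `w` from its mean at outcome `b`. -/
def deviation (w : ℝ) (b : Bool) : ℝ := Real.sign w * (if b = true then 1 else 0) - w

theorem bernoulliWeight_nonneg {w : ℝ} (hw : |w| ≤ 1) (b : Bool) : 0 ≤ bernoulliWeight w b := by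
  cases b <;> simp [bernoulliWeight, hw]

/-- Hoeffding's lemma for one edge: averaging the chord bounds leaves $\cosh k$, since the deviation
has mean zero and the $\sinh k$ term drops out. -/
theorem sum_bernoulliWeight_mul_exp_le {w : ℝ} (hw : |w| ≤ 1) (k : ℝ) :
    ∑ b, bernoulliWeight w b * Real.exp (k * deviation w b) ≤ Real.exp (k ^ 2 / 2) := by
  refine le_trans ?_ (Real.cosh_le_exp_half_sq k)
  have h1 := exp_mul_le_of_abs_le_one k (abs_sign_sub_le_one hw)
  have h2 := exp_mul_le_of_abs_le_one k (z := -w) (by rwa [abs_neg])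
  have h3 := mul_le_mul_of_nonneg_left h1 (abs_nonneg w)
  have h4 := mul_le_mul_of_nonneg_left h2 (sub_nonneg.2 hw)
  have h5 := sign_mul_abs w
  simp only [Fintype.sum_bool, bernoulliWeight, deviation, if_true, mul_one, Bool.false_eq_true,
    if_false, mul_zero, zero_sub]
  rw [Real.cosh_eq]
  have h6 : |w| * ((1 + (Real.sign w - w)) / 2 * Real.exp k +
        (1 - (Real.sign w - w)) / 2 * Real.exp (-k)) +
      (1 - |w|) * ((1 + -w) / 2 * Real.exp k + (1 - -w) / 2 * Real.exp (-k)) =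
      (Real.exp k + Real.exp (-k)) / 2 +
        (Real.sign w * |w| - w) * (Real.exp k - Real.exp (-k)) / 2 := by ring
  rw [h5, sub_self, zero_mul, zero_div, add_zero] at h6
  linarith

/-- Independence of the edges: the sum over all patterns of a product is the product of the one-edge
sums. -/
theorem sum_prod_bernoulliWeight_mul_exp_le {ι : Type*} [Fintype ι] [DecidableEq ι] {w : ι → ℝ}
    (hw : ∀ p, |w p| ≤ 1) (k : ι → ℝ) :
    ∑ e : ι → Bool, (∏ p, bernoulliWeight (w p) (e p)) *
      Real.exp (∑ p, k p * deviation (w p) (e p)) ≤ Real.exp (∑ p, k p ^ 2 / 2) := by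
  simp_rw [Real.exp_sum, ← Finset.prod_mul_distrib]
  rw [← Fintype.prod_sum fun p b => bernoulliWeight (w p) b * Real.exp (k p * deviation (w p) b)]
  exact Finset.prod_le_prod
    (fun p _ => Finset.sum_nonneg fun b _ =>
      mul_nonneg (bernoulliWeight_nonneg (hw p) b) (Real.exp_pos _).le)
    (fun p _ => sum_bernoulliWeight_mul_exp_le (hw p) (k p))

theorem measurable_sign : Measurable Real.sign := by
  have : Real.sign = fun r : ℝ => if r < 0 then (-1 : ℝ) else if 0 < r then 1 else 0 := by
    ext r
    rfl
  rw [this]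
  exact Measurable.ite measurableSet_Iio measurable_const
    (Measurable.ite measurableSet_Ioi measurable_const measurable_const)

theorem measurable_deviation (b : Bool) : Measurable fun w => deviation w b :=
  (measurable_sign.mul_const _).sub measurable_id

variable {Ω : Type*} [MeasurableSpace Ω] {P : Measure Ω} [IsProbabilityMeasure P]
  {W : unitInterval → unitInterval → ℝ} {n : ℕ} {X : Ω → Fin n → unitInterval}

/-- Exponential tail bound for weighted sums of the centred edge variables. -/
theorem IsCondBernoulli.measure_le_sum_deviation (hW : IsKernel W) (hX : Measurable X)
    {η : Pair n → Ω → Bool} (hη : IsCondBernoulli P W X η) (k : Pair n → ℝ) (t : ℝ) {s : ℝ}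
    (hs : 0 ≤ s) :
    P {ω | t ≤ ∑ p : Pair n, k p * deviation (W (X ω p.1.1) (X ω p.1.2)) (η p ω)} ≤
      ENNReal.ofReal (Real.exp (s ^ 2 * (∑ p, k p ^ 2) / 2 - s * t)) := by
  classical
  set w : (Fin n → unitInterval) → Pair n → ℝ := fun x p => W (x p.1.1) (x p.1.2) with hw
  have hwm : ∀ p, Measurable fun x => w x p := fun p =>
    hW.measurable.comp (f := fun x : Fin n → unitInterval => (x p.1.1, x p.1.2))
      ((measurable_pi_apply p.1.1).prodMk (measurable_pi_apply p.1.2))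
  have hw1 : ∀ x p, |w x p| ≤ 1 := fun x p => hW.abs_le_one _ _
  -- Once the pattern `e` is fixed, the tail event is a condition on `X` alone, so the defining
  -- formula of `IsCondBernoulli` applies to it.
  set B : (Pair n → Bool) → Set (Fin n → unitInterval) := fun e =>
    {x | t ≤ ∑ p, k p * deviation (w x p) (e p)} with hB
  have hBm : ∀ e, MeasurableSet (B e) := fun e => measurableSet_le measurable_const
    (Finset.measurable_sum _ fun p _ => ((measurable_deviation (e p)).comp (hwm p)).const_mul _)
  have hweight : ∀ (e : Pair n → Bool) (x : Fin n → unitInterval),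
      (∏ p : Pair n, (if e p = true then ENNReal.ofReal |w x p|
        else ENNReal.ofReal (1 - |w x p|))) =
      ENNReal.ofReal (∏ p, bernoulliWeight (w x p) (e p)) := fun e x => by
    rw [ENNReal.ofReal_prod_of_nonneg fun p _ => bernoulliWeight_nonneg (hw1 x p) _]
    refine Finset.prod_congr rfl fun p _ => ?_
    unfold bernoulliWeight
    split_ifs <;> rfl
  have hwmeas : ∀ e : Pair n → Bool,
      Measurable fun x => ENNReal.ofReal (∏ p, bernoulliWeight (w x p) (e p)) := fun e => by
    refine ENNReal.measurable_ofReal.comp (Finset.measurable_prod _ fun p _ => ?_)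
    unfold bernoulliWeight
    have h1 : Measurable fun x => |w x p| := (hwm p).norm
    split_ifs
    · exact h1
    · exact measurable_const.sub h1
  calc P {ω | t ≤ ∑ p : Pair n, k p * deviation (W (X ω p.1.1) (X ω p.1.2)) (η p ω)}
      ≤ P (⋃ e : Pair n → Bool, {ω | X ω ∈ B e ∧ ∀ p, η p ω = e p}) := by
        refine measure_mono fun ω hω => mem_iUnion.2 ⟨fun p => η p ω, hω, fun p => rfl⟩
    _ ≤ ∑ e : Pair n → Bool, P {ω | X ω ∈ B e ∧ ∀ p, η p ω = e p} :=
        measure_iUnion_fintype_le _ _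
    _ = ∑ e : Pair n → Bool, ∫⁻ ω, (X ⁻¹' B e).indicator
          (fun ω => ENNReal.ofReal (∏ p, bernoulliWeight (w (X ω) p) (e p))) ω ∂P := by
        refine Finset.sum_congr rfl fun e _ => ?_
        rw [hη.2 (B e) e (hBm e), lintegral_indicator (hX (hBm e))]
        exact lintegral_congr fun ω => hweight e (X ω)
    _ = ∫⁻ ω, ∑ e : Pair n → Bool, (X ⁻¹' B e).indicator
          (fun ω => ENNReal.ofReal (∏ p, bernoulliWeight (w (X ω) p) (e p))) ω ∂P := by
        exact (lintegral_finsetSum _ fun e _ =>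
          ((hwmeas e).comp hX).indicator (hX (hBm e))).symm
    _ ≤ ∫⁻ _, ENNReal.ofReal (Real.exp (s ^ 2 * (∑ p, k p ^ 2) / 2 - s * t)) ∂P := by
        refine lintegral_mono fun ω => ?_
        -- Markov's inequality in exponential form: the indicator of $\{t\le S\}$ is at most
        -- $e^{s(S-t)}$.
        have hpt : ∀ e : Pair n → Bool, (X ⁻¹' B e).indicator
            (fun ω => ENNReal.ofReal (∏ p, bernoulliWeight (w (X ω) p) (e p))) ω ≤
            ENNReal.ofReal ((∏ p, bernoulliWeight (w (X ω) p) (e p)) *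
              Real.exp (∑ p, s * k p * deviation (w (X ω) p) (e p)) * Real.exp (-(s * t))) := by
          intro e
          by_cases h : ω ∈ X ⁻¹' B e
          · rw [indicator_of_mem h, mul_assoc, ← Real.exp_add]
            refine ENNReal.ofReal_le_ofReal (le_mul_of_one_le_right
              (Finset.prod_nonneg fun p _ => bernoulliWeight_nonneg (hw1 _ p) _)
              (Real.one_le_exp ?_))
            simp only [mul_assoc, ← Finset.mul_sum]
            have h2 := mul_le_mul_of_nonneg_left (show t ≤ _ from h) hs
            linarith
          · rw [indicator_of_notMem h]
            exact zero_le
        refine (Finset.sum_le_sum fun e _ => hpt e).trans ?_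
        rw [← ENNReal.ofReal_sum_of_nonneg fun e _ => mul_nonneg (mul_nonneg
          (Finset.prod_nonneg fun p _ => bernoulliWeight_nonneg (hw1 _ p) _)
          (Real.exp_pos _).le) (Real.exp_pos _).le, ← Finset.sum_mul]
        refine ENNReal.ofReal_le_ofReal ?_
        rw [sub_eq_add_neg, Real.exp_add]
        refine mul_le_mul_of_nonneg_right ?_ (Real.exp_pos _).le
        refine (sum_prod_bernoulliWeight_mul_exp_le (hw1 (X ω)) fun p => s * k p).trans_eq ?_
        congr 1
        simp only [mul_pow, mul_div_assoc, ← Finset.mul_sum, Finset.sum_div]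
    _ = _ := by simp

end Bernoulli

/-- Sums over the pairs that contain `i` are sums over the nodes other than `i`. -/
theorem sum_pair_eq {n : ℕ} (i : Fin n) (f : Fin n → ℝ) :
    ∑ p : Pair n, (if p.1.1 = i then f p.1.2 else if p.1.2 = i then f p.1.1 else 0) =
      ∑ j ∈ Finset.univ.erase i, f j := by
  have h1 : ∑ p : Pair n, (if p.1.1 = i then f p.1.2 else if p.1.2 = i then f p.1.1 else 0) =
      ∑ p : Fin n × Fin n, if p.1 < p.2 then
        (if p.1 = i then f p.2 else if p.2 = i then f p.1 else 0) else 0 := by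
    rw [← Finset.sum_filter]
    exact (Finset.sum_subtype (Finset.univ.filter fun p : Fin n × Fin n => p.1 < p.2)
      (p := fun p => p.1 < p.2) (by simp)
      (fun p => if p.1 = i then f p.2 else if p.2 = i then f p.1 else 0)).symm
  -- A pair $a<b$ containing `i` has it as either its smaller or its larger entry, never both.
  have h2 : ∀ a b : Fin n, (if a < b then (if a = i then f b else if b = i then f a else 0) else 0)
      = (if a = i then (if i < b then f b else 0) else 0) +
        (if b = i then (if a < i then f a else 0) else 0) := by
    intro a b
    by_cases ha : a = i <;> by_cases hb : b = i
    · subst ha; subst hb; simp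
    · subst ha; simp [hb]
    · subst hb; simp [ha]
    · simp [ha, hb]
  rw [h1, Fintype.sum_prod_type]
  simp only [h2, Finset.sum_add_distrib]
  rw [Finset.sum_comm]
  simp only [Finset.sum_ite_eq', Finset.mem_univ, if_true]
  rw [← Finset.sum_add_distrib, ← Finset.sum_erase_add _ _ (Finset.mem_univ i)]
  simp only [lt_self_iff_false, if_false, add_zero]
  refine Finset.sum_congr rfl fun j hj => ?_
  rcases lt_or_gt_of_ne (Finset.ne_of_mem_erase hj) with h | h
  · simp [h, h.not_gt]
  · simp [h, h.not_gt]

/-! ### Uniform concentration of the row averages of sampled graphs -/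

section Sampled

variable {Ω : Type*} [MeasurableSpace Ω] {P : Measure Ω}
  {W : unitInterval → unitInterval → ℝ}

/-- One-sided tail bound for a weighted row sum of a centred sampled graph. -/
theorem IsSampledGraph.measure_le_row_sum [IsProbabilityMeasure P] {n : ℕ}
    {X : Ω → Fin n → unitInterval}
    {A : Ω → Matrix (Fin n) (Fin n) ℝ} (hW : IsGraphon W) (hX : Measurable X)
    (hA : IsSampledGraph P W X A) {c : Fin n → ℝ} {C : ℝ} (hC : 0 < C) (hc : ∀ j, |c j| ≤ C)
    {ε : ℝ} (hε : 0 ≤ ε) (i : Fin n) :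
    P {ω | n * ε ≤ ∑ j ∈ Finset.univ.erase i, (A ω i j - W (X ω i) (X ω j)) * c j} ≤
      ENNReal.ofReal (Real.exp (-(n * (ε ^ 2 / (2 * C ^ 2))))) := by
  obtain ⟨hsymm, -, η, hη, hAη⟩ := hA
  set k : Pair n → ℝ := fun p => if p.1.1 = i then c p.1.2 else if p.1.2 = i then c p.1.1 else 0
    with hk
  have hk2 : ∑ p, k p ^ 2 ≤ n * C ^ 2 := by
    have h1 : ∀ p : Pair n, k p ^ 2 =
        if p.1.1 = i then c p.1.2 ^ 2 else if p.1.2 = i then c p.1.1 ^ 2 else 0 := fun p => by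
      simp only [hk]
      split_ifs <;> simp
    rw [Finset.sum_congr rfl fun p _ => h1 p, sum_pair_eq i fun j => c j ^ 2]
    calc ∑ j ∈ Finset.univ.erase i, c j ^ 2 ≤ ∑ j, c j ^ 2 :=
          Finset.sum_le_sum_of_subset_of_nonneg (Finset.erase_subset _ _)
            fun j _ _ => sq_nonneg _
      _ ≤ ∑ _j : Fin n, C ^ 2 := Finset.sum_le_sum fun j _ => by
          rw [← sq_abs]
          exact pow_le_pow_left₀ (abs_nonneg _) (hc j) 2
      _ = n * C ^ 2 := by simp
  have hsum : ∀ ω, ∑ p : Pair n, k p * deviation (W (X ω p.1.1) (X ω p.1.2)) (η p ω) =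
      ∑ j ∈ Finset.univ.erase i, (A ω i j - W (X ω i) (X ω j)) * c j := fun ω => by
    rw [← sum_pair_eq i fun j => (A ω i j - W (X ω i) (X ω j)) * c j]
    refine Finset.sum_congr rfl fun p _ => ?_
    have hd : deviation (W (X ω p.1.1) (X ω p.1.2)) (η p ω) =
        A ω p.1.1 p.1.2 - W (X ω p.1.1) (X ω p.1.2) := by rw [hAη]; rfl
    rw [hd]
    simp only [hk]
    split_ifs with h1 h2
    · rw [h1, mul_comm]
    · rw [← h2, hsymm ω p.1.2, hW.symm (X ω p.1.2), mul_comm]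
    · simp
  -- This `s` minimizes the exponent $s^2nC^2/2-sn\varepsilon$.
  have h := hη.measure_le_sum_deviation hW.isKernel hX k (n * ε) (s := ε / C ^ 2) (by positivity)
  simp only [hsum] at h
  refine h.trans (ENNReal.ofReal_le_ofReal (Real.exp_le_exp.2 ?_))
  have h1 : (ε / C ^ 2) ^ 2 * (∑ p, k p ^ 2) / 2 ≤ (ε / C ^ 2) ^ 2 * (n * C ^ 2) / 2 := by
    gcongr
  refine (sub_le_sub_right h1 _).trans_eq ?_
  field_simp
  ring

theorem IsSampledGraph.measure_le_abs_row_sum [IsProbabilityMeasure P] {n : ℕ}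
    {X : Ω → Fin n → unitInterval}
    {A : Ω → Matrix (Fin n) (Fin n) ℝ} (hW : IsGraphon W) (hX : Measurable X)
    (hA : IsSampledGraph P W X A) {c : Fin n → ℝ} {C : ℝ} (hC : 0 < C) (hc : ∀ j, |c j| ≤ C)
    {ε : ℝ} (hε : 0 ≤ ε) (i : Fin n) :
    P {ω | n * ε ≤ |∑ j ∈ Finset.univ.erase i, (A ω i j - W (X ω i) (X ω j)) * c j|} ≤
      ENNReal.ofReal (2 * Real.exp (-(n * (ε ^ 2 / (2 * C ^ 2))))) := by
  have h1 := hA.measure_le_row_sum hW hX hC hc hε i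
  have h2 := hA.measure_le_row_sum hW hX (c := fun j => -c j) hC (by simpa using hc) hε i
  rw [two_mul, ENNReal.ofReal_add (Real.exp_pos _).le (Real.exp_pos _).le]
  refine (measure_mono ?_).trans ((measure_union_le _ _).trans (add_le_add h1 h2))
  intro ω hω
  rw [mem_ofPred_eq] at hω
  rcases le_abs.1 hω with h | h
  · exact Or.inl h
  · refine Or.inr ?_
    simpa using h

theorem summable_natCast_mul_exp_neg {δ : ℝ} (hδ : 0 < δ) :
    Summable fun n : ℕ => (n : ℝ) * (2 * Real.exp (-(n * δ))) := by
  have := (Real.summable_pow_mul_exp_neg_nat_mul 1 hδ).mul_left 2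
  refine this.congr fun n => ?_
  rw [pow_one, mul_left_comm]
  congr 4
  ring

/-- The Borel–Cantelli lemma for real bounds on the probabilities. -/
theorem ae_eventually_notMem_of_le {s : ℕ → Set Ω} {b : ℕ → ℝ} (hb : Summable b)
    (h0 : ∀ n, 0 ≤ b n) (h : ∀ n, P (s n) ≤ ENNReal.ofReal (b n)) :
    ∀ᵐ ω ∂P, ∀ᶠ n in atTop, ω ∉ s n := by
  refine ae_eventually_notMem (ne_top_of_le_ne_top ?_ (ENNReal.tsum_le_tsum h))
  rw [← ENNReal.ofReal_tsum_of_nonneg h0 hb]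
  exact ENNReal.ofReal_ne_top

/-- An almost sure eventual bound for each `ε > 0` holds for all `ε > 0` simultaneously. -/
theorem ae_forall_pos {p : ℝ → Ω → Prop} (hmono : ∀ ε ε' ω, ε ≤ ε' → p ε ω → p ε' ω)
    (h : ∀ ε > 0, ∀ᵐ ω ∂P, p ε ω) : ∀ᵐ ω ∂P, ∀ ε > 0, p ε ω := by
  have h1 : ∀ᵐ ω ∂P, ∀ m : ℕ, p (1 / ((m : ℝ) + 1)) ω :=
    ae_all_iff.2 fun m => h _ (by positivity)
  filter_upwards [h1] with ω hω ε hε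
  obtain ⟨m, hm⟩ := exists_nat_one_div_lt hε
  exact hmono _ _ ω hm.le (hω m)

/-- Almost surely, weighted row averages of a sampled graph are uniformly close to those of the
edge means. -/
theorem ae_eventually_abs_row_average_le [IsProbabilityMeasure P]
    {X : (n : ℕ) → Ω → Fin n → unitInterval}
    {A : (n : ℕ) → Ω → Matrix (Fin n) (Fin n) ℝ} (hW : IsGraphon W) (hX : ∀ n, Measurable (X n))
    (hA : ∀ n, IsSampledGraph P W (X n) (A n)) {c : (n : ℕ) → Fin n → ℝ} {C : ℝ}
    (hc : ∀ n j, |c n j| ≤ C) :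
    ∀ᵐ ω ∂P, ∀ ε > 0, ∀ᶠ n in atTop, ∀ i : Fin n,
      |1 / (n : ℝ) * ∑ j, (A n ω i j - W (X n ω i) (X n ω j)) * c n j| ≤ ε := by
  refine ae_forall_pos (fun ε ε' ω hle h => ?_) fun ε hε => ?_
  · filter_upwards [h] with n hn i using (hn i).trans hle
  have hC' : 0 < |C| + 1 := by positivity
  have hc' : ∀ n j, |c n j| ≤ |C| + 1 := fun n j => by
    have := hc n j
    have := le_abs_self C
    linarith
  have hδ : 0 < (ε / 2) ^ 2 / (2 * (|C| + 1) ^ 2) := by positivity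
  -- Half of `ε` is spent on the independent off-diagonal entries, the other half on the arbitrary
  -- diagonal one, which contributes only $O(1/n)$ to the average.
  have hBC := ae_eventually_notMem_of_le (P := P)
    (s := fun n => ⋃ i : Fin n, {ω | n * (ε / 2) ≤
      |∑ j ∈ Finset.univ.erase i, (A n ω i j - W (X n ω i) (X n ω j)) * c n j|})
    (summable_natCast_mul_exp_neg hδ) (fun n => by positivity) (fun n => by
      refine (measure_iUnion_fintype_le _ _).trans ((Finset.sum_le_sum fun i _ =>
        (hA n).measure_le_abs_row_sum hW (hX n) hC' (hc' n) (half_pos hε).le i).trans ?_)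
      rw [Finset.sum_const, Finset.card_univ, Fintype.card_fin, nsmul_eq_mul,
        ENNReal.ofReal_mul (Nat.cast_nonneg n), ENNReal.ofReal_natCast])
  have hdiag : ∀ᶠ n : ℕ in atTop, 2 * (|C| + 1) / (ε / 2) ≤ n :=
    (tendsto_natCast_atTop_atTop (R := ℝ)).eventually_ge_atTop _
  filter_upwards [hBC] with ω hω
  filter_upwards [hω, hdiag] with n hn hd i
  have hn0 := natCast_pos_of_fin i
  have h1 : |∑ j ∈ Finset.univ.erase i, (A n ω i j - W (X n ω i) (X n ω j)) * c n j|
      < n * (ε / 2) := by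
    by_contra hcon
    exact hn (mem_iUnion.2 ⟨i, not_lt.1 hcon⟩)
  have h2 : |(A n ω i i - W (X n ω i) (X n ω i)) * c n i| ≤ 2 * (|C| + 1) := by
    have hA1 : |A n ω i i| ≤ 1 := by
      rcases (hA n).2.1 ω i i with h | h | h <;> simp [h]
    rw [abs_mul]
    refine mul_le_mul ((abs_sub _ _).trans ?_) (hc' n i) (abs_nonneg _) zero_le_two
    linarith [hW.abs_le_one (X n ω i) (X n ω i)]
  rw [div_le_iff₀ (half_pos hε)] at hd
  rw [← Finset.sum_erase_add _ _ (Finset.mem_univ i), abs_mul, abs_of_pos (by positivity),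
    one_div, inv_mul_le_iff₀ hn0]
  refine (abs_add_le _ _).trans ?_
  linarith

end Sampled

/-! ### Latent variables -/

/-- At every point `x` in the open unit interval, the latent variable of the node whose cell
contains `x` is eventually close to `x`. -/
def LatentConverges (X : (n : ℕ) → Fin n → unitInterval) : Prop :=
  ∀ x : unitInterval, 0 < (x : ℝ) → (x : ℝ) < 1 → ∀ δ > 0, ∀ᶠ n in atTop, ∀ i : Fin n,
    x ∈ cell i → dist (X n i) x < δ

theorem latentConverges_of_isDeterministicLatent {Ω : Type*}
    {X : (n : ℕ) → Ω → Fin n → unitInterval}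
    (hX : ∀ n, IsDeterministicLatent (X n)) (ω : Ω) : LatentConverges fun n => X n ω := by
  intro x hx0 hx1 δ hδ
  have hlarge : ∀ᶠ n : ℕ in atTop, 1 / δ < n :=
    (tendsto_natCast_atTop_atTop (R := ℝ)).eventually_gt_atTop _
  filter_upwards [hlarge] with n hn i hi
  have hn0 := natCast_pos_of_fin i
  rw [div_lt_iff₀ hδ] at hn
  rw [mem_cell_iff] at hi
  rw [Subtype.dist_eq, hX n ω i, Real.dist_eq, abs_lt]
  constructor
  · rw [lt_sub_iff_add_lt, lt_div_iff₀ hn0]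
    nlinarith
  · rw [sub_lt_iff_lt_add, div_lt_iff₀ hn0]
    nlinarith

/-! ### Order statistics of uniform variables -/

section Latent

variable {Ω : Type*} [MeasurableSpace Ω] {P : Measure Ω}

/-- Sorting does not change the number of points below `a`, and in a sorted list these form an
initial segment. Order statistics are thereby controlled by sums of indicators, for measurability as
well as for concentration. -/
theorem lt_card_le_iff {n : ℕ} (u : Fin n → unitInterval) (i : Fin n) (a : ℝ) :
    (i : ℕ) < (Finset.univ.filter fun j => (u j : ℝ) ≤ a).card ↔ (u (Tuple.sort u i) : ℝ) ≤ a := by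
  have hm : Monotone fun j => (u (Tuple.sort u j) : ℝ) :=
    (Subtype.mono_coe _).comp (Tuple.monotone_sort u)
  rw [← Tuple.lt_card_le_iff_apply_le_of_monotone hm]
  have : (Finset.univ.filter fun j => (u j : ℝ) ≤ a).card =
      (Finset.univ.filter fun j => (u (Tuple.sort u j) : ℝ) ≤ a).card := by
    symm
    refine Finset.card_bij (fun j _ => Tuple.sort u j) (fun j hj => by simpa using hj)
      (fun j _ k _ h => (Tuple.sort u).injective h) fun j hj =>
        ⟨(Tuple.sort u).symm j, by simpa using hj, by simp⟩
  rw [this]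

theorem natCast_card_le_eq_sum {n : ℕ} (u : Fin n → unitInterval) (a : ℝ) :
    ((Finset.univ.filter fun j => (u j : ℝ) ≤ a).card : ℝ) =
      ∑ j, (Iic a).indicator (fun _ => (1 : ℝ)) (u j : ℝ) := by
  rw [Finset.card_filter]
  push_cast
  refine Finset.sum_congr rfl fun j _ => ?_
  simp only [indicator, mem_Iic]

theorem measurable_indicator_Iic_coe (a : ℝ) :
    Measurable fun z : unitInterval => (Iic a).indicator (fun _ => (1 : ℝ)) (z : ℝ) :=
  (measurable_const.indicator measurableSet_Iic).comp measurable_subtype_coe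

theorem IsStochasticLatent.measurable {n : ℕ} {X : Ω → Fin n → unitInterval}
    (hX : IsStochasticLatent P X) : Measurable X := by
  obtain ⟨U, hUm, -, -, hXU⟩ := hX
  refine measurable_pi_iff.2 fun i => measurable_of_Iic fun a => ?_
  have : (fun ω => X ω i) ⁻¹' Iic a = {ω | ((i : ℕ) : ℝ) <
      ∑ j, (Iic (a : ℝ)).indicator (fun _ => (1 : ℝ)) (U j ω : ℝ)} := by
    ext ω
    have h := lt_card_le_iff (fun j => U j ω) i a
    have h2 := natCast_card_le_eq_sum (fun j => U j ω) a
    simp only [mem_preimage, mem_Iic, mem_ofPred_eq, ← h2, Nat.cast_lt, hXU]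
    exact h.symm
  rw [this]
  exact measurableSet_lt measurable_const
    (Finset.measurable_sum _ fun j _ => (measurable_indicator_Iic_coe a).comp (hUm j))

theorem IsDeterministicLatent.measurable {n : ℕ} {X : Ω → Fin n → unitInterval}
    (hX : IsDeterministicLatent X) : Measurable X := by
  refine measurable_pi_iff.2 fun i => ?_
  have : ∀ ω ω', X ω i = X ω' i := fun ω ω' => Subtype.ext ((hX ω i).trans (hX ω' i).symm)
  exact measurable_const' this

/-- Hoeffding's inequality for the empirical distribution function of uniform variables. -/
theorem measure_le_abs_card_sub [IsProbabilityMeasure P] {n : ℕ} {U : Fin n → Ω → unitInterval}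
    (hUm : ∀ i, Measurable (U i)) (hUlaw : ∀ i, P.map (U i) = volume) (hUi : iIndepFun U P)
    {a : ℝ} (ha : a ∈ unitInterval) {ε : ℝ} (hε : 0 ≤ ε) :
    P {ω | n * ε ≤ |((Finset.univ.filter fun j => (U j ω : ℝ) ≤ a).card : ℝ) - n * a|} ≤
      ENNReal.ofReal (2 * Real.exp (-(n * (2 * ε ^ 2)))) := by
  -- For $n=0$ the claimed bound is $2$.
  rcases Nat.eq_zero_or_pos n with rfl | hn
  · refine prob_le_one.trans ?_
    simp
  have hn' : (0 : ℝ) < n := Nat.cast_pos.2 hn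
  set Y : Fin n → Ω → ℝ := fun i ω => (Iic a).indicator (fun _ => (1 : ℝ)) (U i ω : ℝ) with hY
  have hYm : ∀ i, Measurable (Y i) := fun i => (measurable_indicator_Iic_coe a).comp (hUm i)
  have hYint : ∀ i, P[Y i] = a := fun i => by
    have h1 : P[Y i] = ∫ z, (Iic a).indicator (fun _ => (1 : ℝ)) ((z : unitInterval) : ℝ) := by
      rw [← hUlaw i, integral_map (hUm i).aemeasurable
        (measurable_indicator_Iic_coe a).aestronglyMeasurable]
    have h2 : (fun z : unitInterval => (Iic a).indicator (fun _ => (1 : ℝ)) (z : ℝ)) =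
        (Iic (⟨a, ha⟩ : unitInterval)).indicator 1 := by
      ext z
      rfl
    rw [h1, h2, integral_indicator_one measurableSet_Iic, measureReal_def, unitInterval.volume_Iic,
      ENNReal.toReal_ofReal ha.1]
  have hsub : ∀ i, HasSubgaussianMGF (fun ω => Y i ω - a) ((‖(1 : ℝ) - 0‖₊ / 2) ^ 2) P := by
    intro i
    have := hasSubgaussianMGF_of_mem_Icc (μ := P) (X := Y i) (a := 0) (b := 1)
      (hYm i).aemeasurable (Eventually.of_forall fun ω => by
        simp only [hY, indicator]
        split_ifs <;> simp)
    rwa [hYint i] at this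
  have hind : iIndepFun (fun i ω => Y i ω - a) P :=
    hUi.comp (fun _ z => (Iic a).indicator (fun _ => (1 : ℝ)) ((z : unitInterval) : ℝ) - a)
      fun _ => (measurable_indicator_Iic_coe a).sub_const _
  have hind' : iIndepFun (fun i ω => -(Y i ω - a)) P :=
    hind.comp (fun _ z => -z) fun _ => measurable_neg
  -- An indicator has variance proxy $1/4$, so the sum has $n/4$.
  have hexp : -((n : ℝ) * ε) ^ 2 / (2 * ((∑ _i : Fin n, (‖(1 : ℝ) - 0‖₊ / 2) ^ 2 : NNReal) : ℝ)) =
      -(n * (2 * ε ^ 2)) := by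
    simp only [sub_zero, nnnorm_one, Finset.sum_const, Finset.card_univ, Fintype.card_fin]
    push_cast
    rw [nsmul_eq_mul]
    field_simp
  have hp1 := HasSubgaussianMGF.measure_sum_ge_le_of_iIndepFun hind (s := Finset.univ)
    (fun i _ => hsub i)
    (ε := n * ε) (by positivity)
  have hp2 := HasSubgaussianMGF.measure_sum_ge_le_of_iIndepFun hind' (s := Finset.univ)
    (fun i _ => (hsub i).neg)
    (ε := n * ε) (by positivity)
  rw [hexp] at hp1 hp2
  rw [measureReal_def, ← ENNReal.le_ofReal_iff_toReal_le (measure_ne_top _ _)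
    (Real.exp_pos _).le] at hp1 hp2
  rw [two_mul, ENNReal.ofReal_add (Real.exp_pos _).le (Real.exp_pos _).le]
  refine (measure_mono ?_).trans ((measure_union_le _ _).trans (add_le_add hp1 hp2))
  intro ω hω
  have hs : ((Finset.univ.filter fun j => (U j ω : ℝ) ≤ a).card : ℝ) - n * a =
      ∑ i, (Y i ω - a) := by
    rw [natCast_card_le_eq_sum (fun j => U j ω) a, Finset.sum_sub_distrib]
    simp [hY]
  rw [mem_ofPred_eq, hs] at hω
  rcases le_abs.1 hω with h | h
  · exact Or.inl h
  · refine Or.inr ?_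
    rw [mem_ofPred_eq, Finset.sum_neg_distrib]
    exact h

/-- Only countably many levels are needed: for rationals $a<x<b$ near $x$, about $na$ samples lie
below $a$ and $nb$ below $b$, which traps an order statistic of index about $nx$ between them. -/
theorem ae_latentConverges_of_isStochasticLatent [IsProbabilityMeasure P]
    {X : (n : ℕ) → Ω → Fin n → unitInterval}
    (hX : ∀ n, IsStochasticLatent P (X n)) : ∀ᵐ ω ∂P, LatentConverges fun n => X n ω := by
  choose U hUm hUlaw hUi hXU using hX
  have h1 : ∀ᵐ ω ∂P, ∀ q : ℚ, (q : ℝ) ∈ unitInterval → ∀ ε > 0, ∀ᶠ n : ℕ in atTop,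
      |((Finset.univ.filter fun j => (U n j ω : ℝ) ≤ q).card : ℝ) - n * q| ≤ n * ε := by
    refine ae_all_iff.2 fun q => ?_
    by_cases hq : (q : ℝ) ∈ unitInterval
    swap
    · exact Eventually.of_forall fun ω h => absurd h hq
    refine (ae_forall_pos (P := P) (p := fun ε ω => ∀ᶠ n : ℕ in atTop,
      |((Finset.univ.filter fun j => (U n j ω : ℝ) ≤ q).card : ℝ) - n * q| ≤ n * ε)
      (fun ε ε' ω hle h => ?_) fun ε hε => ?_).mono fun ω h _ => h
    · filter_upwards [h] with n hn
      exact hn.trans (by gcongr)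
    · have hsum : Summable fun n : ℕ => 2 * Real.exp (-(n * (2 * ε ^ 2))) := by
        have := (Real.summable_pow_mul_exp_neg_nat_mul 0
          (show 0 < 2 * ε ^ 2 by positivity)).mul_left 2
        refine this.congr fun n => ?_
        rw [pow_zero, one_mul]
        congr 2
        ring
      filter_upwards [ae_eventually_notMem_of_le hsum (fun n => by positivity) fun n =>
        measure_le_abs_card_sub (hUm n) (hUlaw n) (hUi n) hq hε.le] with ω hω
      filter_upwards [hω] with n hn
      exact (not_le.1 hn).le
  filter_upwards [h1] with ω hω
  intro x hx0 hx1 δ hδ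
  obtain ⟨a, ha1, ha2⟩ := exists_rat_btwn (max_lt hx0 (sub_lt_self (x : ℝ) hδ))
  obtain ⟨b, hb1, hb2⟩ := exists_rat_btwn (lt_min hx1 (lt_add_of_pos_right (x : ℝ) hδ))
  obtain ⟨ha0, haδ⟩ := max_lt_iff.1 ha1
  obtain ⟨hb0, hbδ⟩ := lt_min_iff.1 hb2
  -- With half the gap as tolerance, the count at `a` stays below $n(x+a)/2<nx\le i+1$, and the
  -- count at `b` stays above $nx>i$.
  have hea := hω a ⟨ha0.le, (ha2.trans hx1).le⟩ ((x - a) / 2) (by linarith)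
  have heb := hω b ⟨(hx0.trans hb1).le, hb0.le⟩ ((b - x) / 2) (by linarith)
  filter_upwards [hea, heb] with n hna hnb i hi
  have hn0 := natCast_pos_of_fin i
  rw [mem_cell_iff] at hi
  have hcount := fun q : ℝ => lt_card_le_iff (fun j => U n j ω) i q
  rw [Subtype.dist_eq, Real.dist_eq, abs_lt, hXU n ω i]
  constructor
  · have hlt : ¬ (i : ℕ) < (Finset.univ.filter fun j => (U n j ω : ℝ) ≤ a).card := by
      intro hcon
      have h2 : ((i : ℕ) : ℝ) + 1 ≤ (Finset.univ.filter fun j => (U n j ω : ℝ) ≤ a).card := by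
        exact_mod_cast hcon
      have h3 := (abs_le.1 hna).2
      nlinarith
    rw [hcount, not_le] at hlt
    linarith
  · have hlt : (i : ℕ) < (Finset.univ.filter fun j => (U n j ω : ℝ) ≤ b).card := by
      have h3 := (abs_le.1 hnb).1
      have h4 : ((i : ℕ) : ℝ) < (Finset.univ.filter fun j => (U n j ω : ℝ) ≤ b).card := by
        nlinarith
      exact_mod_cast h4
    rw [hcount] at hlt
    linarith

end Latent

/-! ### Continuity of piecewise Lipschitz kernels -/

theorem ae_mem_Ioo_zero_one :
    ∀ᵐ x : unitInterval ∂volume, 0 < (x : ℝ) ∧ (x : ℝ) < 1 := by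
  have h0 : ∀ᵐ x ∂(volume : Measure unitInterval), x ≠ 0 := Measure.ae_ne volume 0
  have h1 : ∀ᵐ x ∂(volume : Measure unitInterval), x ≠ 1 := Measure.ae_ne volume 1
  filter_upwards [h0, h1] with x hx0 hx1
  exact ⟨unitInterval.pos_iff_ne_zero.2 hx0, unitInterval.lt_one_iff_ne_one.2 hx1⟩

/-- If `x` lay in no piece, it would pass the breakpoints one after another, including the last. -/
theorem exists_mem_Ioo_of_strictMono {K : ℕ} {α : Fin (K + 2) → ℝ} {x : ℝ} (h0 : α 0 < x)
    (h1 : x < α (Fin.last (K + 1))) (hne : ∀ j, x ≠ α j) :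
    ∃ k : Fin (K + 1), x ∈ Ioo (α k.castSucc) (α k.succ) := by
  by_contra! hcon
  have h : ∀ j, α j < x := fun j => by
    induction j using Fin.induction with
    | zero => exact h0
    | succ k ih => exact lt_of_not_ge fun hle => hcon k ⟨ih, lt_of_le_of_ne hle (hne _)⟩
  exact lt_asymm h1 (h _)

/-- A piecewise Lipschitz kernel is continuous at all points off a null set of lines. -/
theorem IsPiecewiseLipschitz.exists_continuousAt {W : unitInterval → unitInterval → ℝ}
    (hW : IsPiecewiseLipschitz W) :
    ∃ S : Set unitInterval, (∀ᵐ x ∂(volume : Measure unitInterval), x ∈ S) ∧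
      ∀ x ∈ S, ∀ y ∈ S, ContinuousAt (Function.uncurry W) (x, y) := by
  obtain ⟨K, α, L, -, hα0, hα1, hL⟩ := hW
  refine ⟨{x | ∃ k : Fin (K + 1), (x : ℝ) ∈ Ioo (α k.castSucc) (α k.succ)}, ?_, ?_⟩
  · have hne : ∀ᵐ x : unitInterval ∂volume, ∀ j, (x : ℝ) ≠ α j := by
      refine ae_all_iff.2 fun j => ?_
      by_cases hj : α j ∈ unitInterval
      · filter_upwards [Measure.ae_ne (volume : Measure unitInterval) ⟨α j, hj⟩] with x hx hxj
        exact hx (Subtype.ext hxj)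
      · exact Eventually.of_forall fun x hxj => hj (hxj ▸ x.2)
    filter_upwards [ae_mem_Ioo_zero_one, hne] with x hx hxne
    exact exists_mem_Ioo_of_strictMono (hα0 ▸ hx.1) (hα1 ▸ hx.2) hxne
  · rintro x ⟨k, hk⟩ y ⟨l, hl⟩
    have hnear : ∀ᶠ p : unitInterval × unitInterval in 𝓝 (x, y),
        |W p.1 p.2 - W x y| ≤ L * (|(p.1 : ℝ) - x| + |(p.2 : ℝ) - y|) := by
      have h1 : ∀ᶠ p : unitInterval × unitInterval in 𝓝 (x, y),
          (p.1 : ℝ) ∈ Ioo (α k.castSucc) (α k.succ) :=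
        (continuous_subtype_val.comp continuous_fst).continuousAt.eventually_mem
          (Ioo_mem_nhds hk.1 hk.2)
      have h2 : ∀ᶠ p : unitInterval × unitInterval in 𝓝 (x, y),
          (p.2 : ℝ) ∈ Ioo (α l.castSucc) (α l.succ) :=
        (continuous_subtype_val.comp continuous_snd).continuousAt.eventually_mem
          (Ioo_mem_nhds hl.1 hl.2)
      filter_upwards [h1, h2] with p hp1 hp2
      exact hL k l _ _ _ _ hp1 hk hp2 hl
    have hlim : Tendsto (fun p : unitInterval × unitInterval =>
        L * (|(p.1 : ℝ) - x| + |(p.2 : ℝ) - y|)) (𝓝 (x, y)) (𝓝 0) := by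
      have : Continuous fun p : unitInterval × unitInterval =>
        L * (|(p.1 : ℝ) - x| + |(p.2 : ℝ) - y|) := by fun_prop
      simpa using this.tendsto (x, y)
    rw [ContinuousAt, tendsto_iff_dist_tendsto_zero]
    refine squeeze_zero' (Eventually.of_forall fun p => dist_nonneg) ?_ hlim
    filter_upwards [hnear] with p hp
    exact hp

/-- The values of a kernel at the latent variables. -/
def sampleMatrix {n : ℕ} (W : unitInterval → unitInterval → ℝ) (X : Fin n → unitInterval) :
    Matrix (Fin n) (Fin n) ℝ := Matrix.of fun i j => W (X i) (X j)

theorem sampleMatrix_apply {n : ℕ} (W : unitInterval → unitInterval → ℝ)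
    (X : Fin n → unitInterval) (i j : Fin n) : sampleMatrix W X i j = W (X i) (X j) := rfl

/-! ### Convergence along converging latent variables -/

section Convergence

variable {X : (n : ℕ) → Fin n → unitInterval}

theorem LatentConverges.eventually_exists (hX : LatentConverges X) {x : unitInterval}
    (h0 : 0 < (x : ℝ)) (h1 : (x : ℝ) < 1) {s : Set unitInterval} (hs : s ∈ 𝓝 x) :
    ∀ᶠ n in atTop, ∃ i : Fin n, x ∈ cell i ∧ X n i ∈ s := by
  obtain ⟨δ, hδ, hsub⟩ := Metric.mem_nhds_iff.1 hs
  filter_upwards [hX x h0 h1 δ hδ, eventually_gt_atTop 0] with n hn hpos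
  obtain ⟨i, hi⟩ := exists_mem_cell hpos h0
  exact ⟨i, hi, hsub (hn i hi)⟩

theorem LatentConverges.tendsto_stepFunction (hX : LatentConverges X) {x : unitInterval}
    (h0 : 0 < (x : ℝ)) (h1 : (x : ℝ) < 1) {g : unitInterval → ℝ} (hg : ContinuousAt g x) :
    Tendsto (fun n => stepFunction (fun i => g (X n i)) x) atTop (𝓝 (g x)) := by
  refine tendsto_def.2 fun s hs => ?_
  filter_upwards [hX.eventually_exists h0 h1 (hg hs)] with n ⟨i, hi, his⟩
  simpa [stepFunction_of_mem _ hi] using his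

theorem LatentConverges.tendsto_stepKernel (hX : LatentConverges X) {x y : unitInterval}
    (hx0 : 0 < (x : ℝ)) (hx1 : (x : ℝ) < 1) (hy0 : 0 < (y : ℝ)) (hy1 : (y : ℝ) < 1)
    {W : unitInterval → unitInterval → ℝ} (hW : ContinuousAt (Function.uncurry W) (x, y)) :
    Tendsto (fun n => stepKernel (sampleMatrix W (X n)) x y) atTop (𝓝 (W x y)) := by
  refine tendsto_def.2 fun s hs => ?_
  obtain ⟨a, ha, b, hb, hab⟩ := mem_nhds_prod_iff.1 (hW hs)
  filter_upwards [hX.eventually_exists hx0 hx1 ha, hX.eventually_exists hy0 hy1 hb]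
    with n ⟨i, hi, hia⟩ ⟨j, hj, hjb⟩
  have : (X n i, X n j) ∈ Function.uncurry W ⁻¹' s := hab ⟨hia, hjb⟩
  rw [mem_preimage, stepKernel_of_mem _ hi, stepFunction_of_mem _ hj, sampleMatrix_apply]
  exact this

/-- If the weighted row averages of `A n` approach those of `W` at the latent variables, then the
integral operators of the step kernels converge almost everywhere. -/
theorem ae_tendsto_integral_stepKernel_mul (hX : LatentConverges X)
    {W : unitInterval → unitInterval → ℝ} (hW : IsKernel W) (hWL : IsPiecewiseLipschitz W)
    {A : (n : ℕ) → Matrix (Fin n) (Fin n) ℝ} {f : unitInterval → ℝ} (hf : Integrable f)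
    (hA : ∀ ε > 0, ∀ᶠ n in atTop, ∀ i : Fin n, |1 / (n : ℝ) * ∑ j,
      (A n i j - W (X n i) (X n j)) * (n * ∫ y in cell j, f y)| ≤ ε) :
    ∀ᵐ x ∂(volume : Measure unitInterval), Tendsto (fun n => ∫ y, stepKernel (A n) x y * f y)
      atTop (𝓝 (∫ y, W x y * f y)) := by
  obtain ⟨S, hS, hcont⟩ := hWL.exists_continuousAt
  filter_upwards [hS, ae_mem_Ioo_zero_one] with x hxS hx
  have hWn : ∀ n, IsKernel (stepKernel (sampleMatrix W (X n))) := fun n =>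
    isKernel_stepKernel fun i j => hW.abs_le_one _ _
  have h1 : Tendsto (fun n => ∫ y, stepKernel (sampleMatrix W (X n)) x y * f y) atTop
      (𝓝 (∫ y, W x y * f y)) := by
    refine tendsto_integral_of_dominated_convergence (fun y => |f y|)
      (fun n => ((hWn n).integrable_mul hf x).aestronglyMeasurable) hf.abs
      (fun n => Eventually.of_forall fun y => ?_) ?_
    · rw [norm_mul]
      exact mul_le_of_le_one_left (norm_nonneg _) ((hWn n).abs_le_one x y)
    · filter_upwards [hS, ae_mem_Ioo_zero_one] with y hyS hy
      exact (hX.tendsto_stepKernel hx.1 hx.2 hy.1 hy.2 (hcont x hxS y hyS)).mul_const _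
  -- At a point of cell `i` this difference is exactly the row average of `hA`, with the cell
  -- averages of `f` as weights.
  have h2 : Tendsto (fun n => (∫ y, stepKernel (A n) x y * f y) -
      ∫ y, stepKernel (sampleMatrix W (X n)) x y * f y) atTop (𝓝 0) := by
    rw [Metric.tendsto_atTop']
    intro ε hε
    obtain ⟨N, hN⟩ := eventually_atTop.1 ((hA (ε / 2) (half_pos hε)).and (eventually_gt_atTop 0))
    refine ⟨N, fun n hn => ?_⟩
    obtain ⟨hn1, hn0⟩ := hN n hn.le
    obtain ⟨i, hi⟩ := exists_mem_cell hn0 hx.1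
    have hn' : (n : ℝ) ≠ 0 := Nat.cast_ne_zero.2 hn0.ne'
    have heq : (∫ y, stepKernel (A n) x y * f y) -
        (∫ y, stepKernel (sampleMatrix W (X n)) x y * f y) =
        1 / (n : ℝ) * ∑ j, (A n i j - W (X n i) (X n j)) * (n * ∫ y in cell j, f y) := by
      simp only [stepKernel_of_mem _ hi, integral_stepFunction_mul _ hf]
      rw [← Finset.sum_sub_distrib, Finset.mul_sum]
      refine Finset.sum_congr rfl fun j _ => ?_
      rw [sampleMatrix_apply]
      field_simp
    rw [Real.dist_0_eq_abs, heq]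
    exact (hn1 i).trans_lt (half_lt_self hε)
  simpa using h2.add h1

end Convergence

/-! ### Convergence in `L²` -/

/-- The bounded convergence theorem in `L²`. -/
theorem tendsto_L2_of_ae_tendsto {F : ℕ → Lp ℝ 2 (volume : Measure unitInterval)}
    {G : Lp ℝ 2 (volume : Measure unitInterval)} {C : ℝ}
    (hF : ∀ n, ∀ᵐ x ∂(volume : Measure unitInterval), |F n x| ≤ C)
    (h : ∀ᵐ x ∂(volume : Measure unitInterval), Tendsto (fun n => F n x) atTop (𝓝 (G x))) :
    Tendsto F atTop (𝓝 G) := by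
  have hF' := ae_all_iff.2 hF
  have hG : ∀ᵐ x ∂(volume : Measure unitInterval), |G x| ≤ C := by
    filter_upwards [hF', h] with x hx hlim
    exact le_of_tendsto hlim.abs (Eventually.of_forall hx)
  have hnorm : ∀ n, ‖F n - G‖ ^ 2 = ∫ x, (F n x - G x) ^ 2 := fun n => by
    rw [← real_inner_self_eq_norm_sq, L2.inner_def]
    refine integral_congr_ae ?_
    filter_upwards [Lp.coeFn_sub (F n) G] with x hx
    rw [hx, Pi.sub_apply, real_inner_self_eq_norm_sq, Real.norm_eq_abs, sq_abs]
  have hint : Tendsto (fun n => ∫ x, (F n x - G x) ^ 2) atTop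
      (𝓝 (∫ _x : unitInterval, (0 : ℝ))) := by
    refine tendsto_integral_of_dominated_convergence (fun _ => (2 * C) ^ 2)
      (fun n => ((Lp.aestronglyMeasurable (F n)).sub (Lp.aestronglyMeasurable G)).pow 2)
      (integrable_const _) (fun n => ?_) ?_
    · filter_upwards [hF n, hG] with x h1 h2
      rw [norm_pow, Real.norm_eq_abs]
      refine pow_le_pow_left₀ (abs_nonneg _) ((abs_sub _ _).trans ?_) 2
      linarith
    · filter_upwards [h] with x hx
      simpa using (hx.sub_const (G x)).pow 2
  rw [tendsto_iff_norm_sub_tendsto_zero]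
  have := hint.sqrt
  simp only [← hnorm, integral_zero, Real.sqrt_zero] at this
  simpa [Real.sqrt_sq] using this

theorem ae_abs_le_norm (f : Lp ℝ ∞ (volume : Measure unitInterval)) :
    ∀ᵐ x ∂(volume : Measure unitInterval), |f x| ≤ ‖f‖ := by
  filter_upwards [ae_le_eLpNormEssSup (f := f) (μ := (volume : Measure unitInterval))] with x hx
  rw [← eLpNorm_exponent_top] at hx
  simpa [Lp.norm_def] using ENNReal.toReal_mono (Lp.eLpNorm_ne_top f) hx

theorem abs_drift_le {V D : unitInterval → unitInterval → ℝ} (hV : IsKernel V) (hD : IsKernel D)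
    {f : unitInterval → ℝ} (hf : Integrable f) {C : ℝ}
    (hC : ∀ᵐ x ∂(volume : Measure unitInterval), |f x| ≤ C) :
    ∀ᵐ x ∂(volume : Measure unitInterval), |drift V D f x| ≤ 2 * C := by
  have h1 : ∫ y, |f y| ≤ C := by
    have := integral_mono_ae hf.abs (integrable_const C) hC
    simpa using this
  filter_upwards [hC] with x hx
  have h2 := hV.abs_integral_mul_le hf x
  have h3 := hD.abs_integral_le x
  have h4 : |(∫ y, D x y) * f x| ≤ |f x| := by
    rw [abs_mul]
    exact mul_le_of_le_one_left (abs_nonneg _) h3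
  refine (abs_sub _ _).trans ?_
  linarith

/-- Gives the uniform bound on the weights that the concentration estimate requires. -/
theorem abs_natCast_mul_setIntegral_cell_le {n : ℕ} (j : Fin n) {f : unitInterval → ℝ} {C : ℝ}
    (hC : ∀ᵐ x ∂(volume : Measure unitInterval), |f x| ≤ C) :
    |(n : ℝ) * ∫ y in cell j, f y| ≤ C := by
  have hn := natCast_pos_of_fin j
  have h1 := norm_setIntegral_le_of_norm_le_const_ae (μ := (volume : Measure unitInterval))
    (s := cell j) (f := f) (C := C) (measure_lt_top _ _) (ae_restrict_of_ae hC)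
  rw [measureReal_cell, Real.norm_eq_abs] at h1
  rw [abs_mul, abs_of_pos hn]
  calc (n : ℝ) * |∫ y in cell j, f y| ≤ n * (C * (1 / n)) := by gcongr
    _ = C := by field_simp

/-! ### Absolute values of graphons and sampled graphs -/

theorem IsGraphon.abs {W : unitInterval → unitInterval → ℝ} (hW : IsGraphon W) :
    IsGraphon fun x y => |W x y| where
  measurable := hW.measurable.norm
  symm x y := by rw [hW.symm]
  abs_le_one x y := by rw [abs_abs]; exact hW.abs_le_one x y

theorem IsPiecewiseLipschitz.abs {W : unitInterval → unitInterval → ℝ}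
    (hW : IsPiecewiseLipschitz W) : IsPiecewiseLipschitz fun x y => |W x y| := by
  obtain ⟨K, α, L, h1, h2, h3, hL⟩ := hW
  exact ⟨K, α, L, h1, h2, h3, fun k l x x' y y' hx hx' hy hy' =>
    (abs_abs_sub_abs_le_abs_sub _ _).trans (hL k l x x' y y' hx hx' hy hy')⟩

theorem sign_abs_eq_abs_sign (w : ℝ) : Real.sign |w| = |Real.sign w| := by
  rcases lt_trichotomy w 0 with h | h | h
  · rw [Real.sign_of_neg h, Real.sign_of_pos (abs_pos.2 h.ne)]; simp
  · simp [h]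
  · rw [abs_of_pos h, Real.sign_of_pos h, abs_one]

section

variable {Ω : Type*} [MeasurableSpace Ω] {P : Measure Ω} {W : unitInterval → unitInterval → ℝ}

/-- The unsigned graph of a graph sampled from `W` is sampled from `|W|`. -/
theorem IsSampledGraph.abs {n : ℕ} {X : Ω → Fin n → unitInterval}
    {A : Ω → Matrix (Fin n) (Fin n) ℝ} (hA : IsSampledGraph P W X A) :
    IsSampledGraph P (fun x y => |W x y|) X fun ω => Matrix.of fun i j => |A ω i j| := by
  obtain ⟨hsymm, hval, η, hη, hAη⟩ := hA
  refine ⟨fun ω i j => ?_, fun ω i j => ?_, η, ⟨hη.1, fun B e hB => ?_⟩, fun ω p => ?_⟩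
  · simp only [Matrix.of_apply, hsymm ω i j]
  · simp only [Matrix.of_apply]
    rcases hval ω i j with h | h | h <;> simp [h]
  · simp only [abs_abs]
    exact hη.2 B e hB
  · simp only [Matrix.of_apply]
    rw [hAη, abs_mul, sign_abs_eq_abs_sign]
    split_ifs <;> simp

theorem IsSampledGraph.abs_le_one {n : ℕ} {X : Ω → Fin n → unitInterval}
    {A : Ω → Matrix (Fin n) (Fin n) ℝ} (hA : IsSampledGraph P W X A) (ω : Ω) (i j : Fin n) :
    |A ω i j| ≤ 1 := by
  rcases hA.2.1 ω i j with h | h | h <;> simp [h]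

/-! ### Convergence of the dynamics -/

variable [IsProbabilityMeasure P] {W' : unitInterval → unitInterval → ℝ}
  {X : (n : ℕ) → Ω → Fin n → unitInterval} {A A' : (n : ℕ) → Ω → Matrix (Fin n) (Fin n) ℝ}

/-- Almost surely, the operators of the sampled graphs converge to that of the graphon at a given
bounded function. -/
theorem ae_tendsto_kernelOp (hW : IsGraphon W) (hWL : IsPiecewiseLipschitz W) (hW' : IsGraphon W')
    (hWL' : IsPiecewiseLipschitz W') (hXm : ∀ n, Measurable (X n))
    (hX : ∀ᵐ ω ∂P, LatentConverges fun n => X n ω)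
    (hA : ∀ n, IsSampledGraph P W (X n) (A n)) (hA' : ∀ n, IsSampledGraph P W' (X n) (A' n))
    (f : Lp ℝ ∞ (volume : Measure unitInterval)) :
    ∀ᵐ ω ∂P, Tendsto (fun n => kernelOp (isKernel_stepKernel ((hA n).abs_le_one ω))
      (isKernel_stepKernel ((hA' n).abs_le_one ω)) (toL2 f)) atTop
      (𝓝 (kernelOp hW.isKernel hW'.isKernel (toL2 f))) := by
  have hf : Integrable f (volume : Measure unitInterval) := (Lp.memLp f).integrable le_top
  have hone : ∀ᵐ x ∂(volume : Measure unitInterval), |(fun _ => (1 : ℝ)) x| ≤ 1 :=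
    Eventually.of_forall fun _ => abs_one.le
  have hrow := ae_eventually_abs_row_average_le hW hXm hA
    fun n (j : Fin n) => abs_natCast_mul_setIntegral_cell_le j (ae_abs_le_norm f)
  -- The decay rates are row integrals, that is, the case of the constant function $1$.
  have hrow' := ae_eventually_abs_row_average_le hW' hXm hA'
    fun n (j : Fin n) => abs_natCast_mul_setIntegral_cell_le j hone
  filter_upwards [hX, hrow, hrow'] with ω hXω h1 h2
  have hcoe : ∀ {V D : unitInterval → unitInterval → ℝ} (hV : IsKernel V) (hD : IsKernel D),
      kernelOp hV hD (toL2 f) =ᵐ[volume] drift V D f := fun hV hD =>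
    (coeFn_kernelOp hV hD _).trans (drift_congr_ae (coeFn_toL2 f))
  have hk := fun n => isKernel_stepKernel ((hA n).abs_le_one ω)
  have hk' := fun n => isKernel_stepKernel ((hA' n).abs_le_one ω)
  refine tendsto_L2_of_ae_tendsto (C := 2 * ‖f‖) (fun n => ?_) ?_
  · filter_upwards [hcoe (hk n) (hk' n), abs_drift_le (hk n) (hk' n) hf (ae_abs_le_norm f)]
      with x hx1 hx2
    rw [hx1]
    exact hx2
  · filter_upwards [ae_all_iff.2 fun n => hcoe (hk n) (hk' n), hcoe hW.isKernel hW'.isKernel,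
      ae_tendsto_integral_stepKernel_mul hXω hW.isKernel hWL hf h1,
      ae_tendsto_integral_stepKernel_mul hXω hW'.isKernel hWL' (integrable_const 1) h2]
      with x hx1 hx2 hx3 hx4
    simp only [hx1, hx2]
    simp only [mul_one] at hx4
    exact hx3.sub (hx4.mul_const _)

/-- Nonnegative rational times are dense in `[0,∞)`. -/
theorem mem_closure_image_ratCast {E : Type*} [TopologicalSpace E] {U : ℝ → E}
    (hU : ContinuousOn U (Ici 0)) {t : ℝ} (ht : 0 ≤ t) :
    U t ∈ closure {x | ∃ q : ℚ, 0 ≤ (q : ℝ) ∧ U q = x} := by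
  have h1 : t ∈ closure (Ioi (0 : ℝ) ∩ range ((↑) : ℚ → ℝ)) := by
    refine closure_minimal (Rat.denseRange_cast.open_subset_closure_inter isOpen_Ioi)
      isClosed_closure ?_
    rwa [closure_Ioi]
  have h2 := ((hU t ht).mono (inter_subset_left.trans Ioi_subset_Ici_self)).mem_closure_image h1
  refine closure_mono ?_ h2
  rintro _ ⟨_, ⟨hq, q, rfl⟩, rfl⟩
  exact ⟨q, le_of_lt hq, rfl⟩

/-- Convergence for the dynamics with interactions sampled from `W` and decay rates sampled
from `W'`. -/
theorem ae_maxErrorTendsToZero (hW : IsGraphon W) (hWL : IsPiecewiseLipschitz W)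
    (hW' : IsGraphon W') (hWL' : IsPiecewiseLipschitz W') (hXm : ∀ n, Measurable (X n))
    (hX : ∀ᵐ ω ∂P, LatentConverges fun n => X n ω)
    (hA : ∀ n, IsSampledGraph P W (X n) (A n)) (hA' : ∀ n, IsSampledGraph P W' (X n) (A' n))
    {g : unitInterval → ℝ} (hgb : ∃ C : ℝ, ∀ x, |g x| ≤ C)
    (hgc : ∀ᵐ x ∂(volume : Measure unitInterval), ContinuousAt g x) {T : ℝ} (hT : 0 ≤ T)
    {u : ℝ → Lp ℝ ∞ (volume : Measure unitInterval)} {v : (n : ℕ) → Ω → ℝ → Fin n → ℝ}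
    (hu : ContDiffOn ℝ 1 u (Ici 0)) (hu0 : u 0 =ᵐ[volume] g)
    (hu' : ∀ t, 0 ≤ t → (derivWithin u (Ici 0) t : Lp ℝ ∞ (volume : Measure unitInterval)) =ᵐ[volume]
      drift W W' (u t))
    (hv0 : ∀ n ω i, v n ω 0 i = g (X n ω i))
    (hv' : ∀ n ω t, 0 ≤ t → ∀ i, HasDerivWithinAt (fun s => v n ω s i)
      (graphDrift (A n ω) (A' n ω) (v n ω t) i) (Ici 0) t) :
    ∀ᵐ ω ∂P, MaxErrorTendsToZero T (fun n => v n ω) u := by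
  obtain ⟨C, hC⟩ := hgb
  have hC0 : 0 ≤ C := (abs_nonneg _).trans (hC 0)
  -- Countably many times, so that one null set serves them all.
  have hrat : ∀ᵐ ω ∂P, ∀ q : ℚ, Tendsto (fun n =>
      kernelOp (isKernel_stepKernel ((hA n).abs_le_one ω))
        (isKernel_stepKernel ((hA' n).abs_le_one ω)) (toL2 (u q))) atTop
      (𝓝 (kernelOp hW.isKernel hW'.isKernel (toL2 (u q)))) :=
    ae_all_iff.2 fun q => ae_tendsto_kernelOp hW hWL hW' hWL' hXm hX hA hA' (u q)
  have hUc : ContinuousOn (fun t => toL2 (u t)) (Ici 0) :=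
    toL2.continuous.comp_continuousOn hu.continuousOn
  filter_upwards [hX, hrat] with ω hXω hω
  have hU : ∀ t, 0 ≤ t → HasDerivWithinAt (fun t => toL2 (u t))
      (kernelOp hW.isKernel hW'.isKernel (toL2 (u t))) (Ici 0) t := fun t ht => by
    have h1 : HasDerivWithinAt u (derivWithin u (Ici 0) t) (Ici 0) t :=
      (hu.differentiableOn one_ne_zero t ht).hasDerivWithinAt
    have h2 : kernelOp hW.isKernel hW'.isKernel (toL2 (u t)) =
        toL2 (derivWithin u (Ici 0) t) := by
      refine Lp.ext ((coeFn_kernelOp _ _ _).trans ?_)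
      exact (drift_congr_ae (coeFn_toL2 (u t))).trans
        ((hu' t ht).symm.trans (coeFn_toL2 _).symm)
    rw [h2]
    exact toL2.hasFDerivAt.comp_hasDerivWithinAt t h1
  have hs : ∀ n t, 0 ≤ t → HasDerivWithinAt (fun t => stepLp n (v n ω t))
      (kernelOp (isKernel_stepKernel ((hA n).abs_le_one ω))
        (isKernel_stepKernel ((hA' n).abs_le_one ω)) (stepLp n (v n ω t))) (Ici 0) t :=
    fun n t ht => by
      rw [kernelOp_stepLp ((hA n).abs_le_one ω) ((hA' n).abs_le_one ω)]
      exact (stepLp n).hasFDerivAt.comp_hasDerivWithinAt t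
        (hasDerivWithinAt_pi.2 fun i => hv' n ω t ht i)
  have h0 : Tendsto (fun n => stepLp n (v n ω 0)) atTop (𝓝 (toL2 (u 0))) := by
    have hv : ∀ n, v n ω 0 = fun i => g (X n ω i) := fun n => funext (hv0 n ω)
    refine tendsto_L2_of_ae_tendsto (C := C) (fun n => ?_) ?_
    · filter_upwards [coeFn_stepLp (v n ω 0)] with x hx
      rw [hx, hv]
      exact abs_stepFunction_le hC0 (fun i => hC _) x
    · filter_upwards [ae_all_iff.2 fun n => coeFn_stepLp (v n ω 0), coeFn_toL2 (u 0), hu0, hgc,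
        ae_mem_Ioo_zero_one] with x hx1 hx2 hx3 hx4 hx5
      simp only [hx1, hx2, hx3]
      simp only [hv]
      exact hXω.tendsto_stepFunction hx5.1 hx5.2 hx4
  obtain ⟨M, hM, hM0⟩ := exists_isGreatest_norm_sub_of_flow
    (fun n => norm_kernelOp_le (isKernel_stepKernel ((hA n).abs_le_one ω))
      -- Real times are reached from the rational ones by continuity of the trajectory and the
      -- uniform bound $2$.
      (isKernel_stepKernel ((hA' n).abs_le_one ω))) hs hU h0 hT (fun t ht =>
        tendsto_apply_of_mem_closure (fun n => norm_kernelOp_le _ _)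
          (by rintro _ ⟨q, -, rfl⟩; exact hω q) (mem_closure_image_ratCast hUc ht.1))
  refine ⟨fun n => ENNReal.ofReal (M n), fun n => ?_, ?_⟩
  · have hnorm : ∀ t, eLpNorm (fun x => stepFunction (v n ω t) x - u t x) 2 volume =
        ENNReal.ofReal ‖stepLp n (v n ω t) - toL2 (u t)‖ := fun t => by
      rw [Lp.norm_def, ENNReal.ofReal_toReal (Lp.eLpNorm_ne_top _)]
      refine eLpNorm_congr_ae ?_
      filter_upwards [Lp.coeFn_sub (stepLp n (v n ω t)) (toL2 (u t)), coeFn_stepLp (v n ω t),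
        coeFn_toL2 (u t)] with x h1 h2 h3
      rw [h1, Pi.sub_apply, h2, h3]
    have := Monotone.map_isGreatest (f := ENNReal.ofReal)
      (fun _ _ h => ENNReal.ofReal_le_ofReal h) (hM n)
    rw [image_image] at this
    simpa only [hnorm] using this
  · simpa using ENNReal.tendsto_ofReal hM0

end

end SignedGraphon

end

/-! ### The two dynamics as instances of the general flow -/

theorem theorem3 {Ω : Type*} [MeasurableSpace Ω] (P : Measure Ω) [IsProbabilityMeasure P]
    (W : unitInterval → unitInterval → ℝ)
    (hW : SignedGraphon.IsGraphon W) (hWL : SignedGraphon.IsPiecewiseLipschitz W)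
    (g : unitInterval → ℝ) (hgb : ∃ C : ℝ, ∀ x, |g x| ≤ C)
    (hgc : ∀ᵐ x ∂(volume : Measure unitInterval), ContinuousAt g x)
    (X : (n : ℕ) → Ω → Fin n → unitInterval)
    (hX : (∀ n, SignedGraphon.IsDeterministicLatent (X n)) ∨
      (∀ n, SignedGraphon.IsStochasticLatent P (X n)))
    (A : (n : ℕ) → Ω → Matrix (Fin n) (Fin n) ℝ)
    (hA : ∀ n, SignedGraphon.IsSampledGraph P W (X n) (A n))
    (T : ℝ) (hT : 0 < T) :
    (∀ (u : ℝ → Lp ℝ ∞ (volume : Measure unitInterval)) (v : (n : ℕ) → Ω → ℝ → Fin n → ℝ),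
      SignedGraphon.IsRepellingGraphonSolution W g u →
      (∀ n ω, SignedGraphon.IsRepellingGraphSolution (A n ω) (fun i => g (X n ω i)) (v n ω)) →
      ∀ᵐ ω ∂P, SignedGraphon.MaxErrorTendsToZero T (fun n => v n ω) u) ∧
    (∀ (u : ℝ → Lp ℝ ∞ (volume : Measure unitInterval)) (v : (n : ℕ) → Ω → ℝ → Fin n → ℝ),
      SignedGraphon.IsOpposingGraphonSolution W g u →
      (∀ n ω, SignedGraphon.IsOpposingGraphSolution (A n ω) (fun i => g (X n ω i)) (v n ω)) →
      ∀ᵐ ω ∂P, SignedGraphon.MaxErrorTendsToZero T (fun n => v n ω) u) := by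
  have hXm : ∀ n, Measurable (X n) := fun n =>
    hX.elim (fun h => (h n).measurable) fun h => (h n).measurable
  have hXc : ∀ᵐ ω ∂P, SignedGraphon.LatentConverges fun n => X n ω :=
    hX.elim
      (fun h => Eventually.of_forall (SignedGraphon.latentConverges_of_isDeterministicLatent h))
      SignedGraphon.ae_latentConverges_of_isStochasticLatent
  refine ⟨fun u v hu hv => ?_, fun u v hu hv => ?_⟩
  · refine SignedGraphon.ae_maxErrorTendsToZero hW hWL hW hWL hXm hXc hA hA hgb hgc hT.le
      hu.1 hu.2.1 (fun t ht => (hu.2.2 t ht).trans (Eventually.of_forall fun x => ?_))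
      (fun n ω => (hv n ω).1) fun n ω t ht i => ?_
    · have hint := (Lp.memLp (u t)).integrable le_top
      simp only [mul_sub, SignedGraphon.drift]
      rw [integral_sub (hW.isKernel.integrable_mul hint x)
        ((hW.isKernel.integrable x).mul_const _), integral_mul_const]
    · convert (hv n ω).2 t ht i using 1
      simp only [SignedGraphon.graphDrift, mul_sub, Finset.sum_sub_distrib, ← Finset.sum_mul]
      ring
  -- The decay kernel is $|W|$, and its graph $|A|$ is sampled from $|W|$ with the same edge
  -- variables; no independence between `A` and $|A|$ is needed.
  · refine SignedGraphon.ae_maxErrorTendsToZero hW hWL hW.abs hWL.abs hXm hXc hA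
      (fun n => (hA n).abs) hgb hgc hT.le hu.1 hu.2.1
      (fun t ht => (hu.2.2 t ht).trans (Eventually.of_forall fun x => ?_))
      (fun n ω => (hv n ω).1) fun n ω t ht i => ?_
    · simp only [SignedGraphon.drift, integral_mul_const]
    · convert (hv n ω).2 t ht i using 1
      simp only [SignedGraphon.graphDrift, Matrix.of_apply, ← Finset.sum_mul]
      ring
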